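/- Consider the system $\dot x=F(x,y,z)$, $\dot y=G(x,y,z)$, $\dot z=H(x,y,z)$ (real time), where $F,G,H$ are holomorphic on an open neighbourhood $U$ of the origin of $\mathbb C^3$ and vanish at the origin. Assume that its linear part $\Lambda$ at the origin has three distinct purely imaginary (nonzero) eigenvalues $i\omega_1,i\omega_2,i\omega_3$, with the $x$-axis, the $y$-axis and the $z$-axis as the respective eigenspaces, and $|\omega_1|\le|\omega_2|\le|\omega_3|$. An $x$-invariant holomorphic center manifold is the graph, over a disc around $0$ in the $x$-axis, of a holomorphic map $x\mapsto(y(x),z(x))$ with $y(0)=z(0)=0$ and $y'(0)=z'(0)=0$, which is contained in $U$ and locally invariant under the system; $y$- and $z$-invariant ones are defined likewise. Two of them are identified if they coincide near the origin. Such a manifold $M$ contains an isochronous center family of period $T$ if all points of $M\setminus\{0\}$ close enough to the origin lie on periodic orbits of minimal period $T$ that are contained in $M$, and these orbits stay in any prescribed neighbourhood of $0$ when they start close enough to $0$. Reduced coefficients. A Briot--Bouquet system is a system $tu'=f(t,u,v)=pt+qu+\cdots$, $tv'=g(t,u,v)=rt+sv+\cdots$, with $f,g$ holomorphic near the origin and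 vanishing there, the dots standing for terms of order at least two. One reduction step is the change of unknowns $u=t\bigl(\tilde u+\tfrac{p}{1-q}\bigr)$, $v=t\bigl(\tilde v+\tfrac{r}{1-s}\bigr)$; it leads to a Briot--Bouquet system for $(\tilde u,\tilde v)$ with $q,s$ replaced by $q-1,s-1$. If $q=1$ and $p=0$ the constant $\tfrac p{1-q}$ in this step is replaced by a free constant $c\in\mathbb C$. The invariance equations of a curve $(x,y,z)=(t,tu(t),tv(t))$ are the Briot--Bouquet system $(B_x)$: $tu'=G/F-u$, $tv'=H/F-v$, with $F,G,H$ evaluated at $(t,tu,tv)$, for which $q=\omega_2/\omega_1-1$, $s=\omega_3/\omega_1-1$. Those of a curve $(x,y,z)=(tu(t),t,tv(t))$ are the system $(B_y)$: $tu'=F/G-u$, $tv'=H/G-v$, with $F,G,H$ evaluated at $(tu,t,tv)$, for which $q=\omega_1/\omega_2-1$, $s=\omega_3/\omega_2-1$. * If $\omega_3/\omega_2\in\mathbb N$, let $\bar r$ be the coefficient of $t$ in the second equation after $\omega_3/\omega_2-2$ reduction steps applied to $(B_y)$. * If $\omega_2/\omega_1\in\mathbb N$, let $\bar p$ be the coefficient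 of $t$ in the first equation after $\omega_2/\omega_1-2$ reduction steps applied to $(B_x)$. * If $\omega_3/\omega_1\in\mathbb N$, let $\hat r$ be the coefficient of $t$ in the second equation after $\omega_3/\omega_1-2$ reduction steps applied to $(B_x)$. If moreover $\omega_2/\omega_1\in\mathbb N$ and $\bar p=0$, then one of these steps involves the free constant $c$, and $\hat r=\hat r(c)$ is a function of $c\in\mathbb C$. Then: 1) There is exactly one $z$-invariant holomorphic center manifold at the origin, and it contains an isochronous center family of period $2\pi/|\omega_3|$. 2) If $\omega_3/\omega_2\notin\mathbb N$, there is exactly one $y$-invariant holomorphic center manifold at the origin, and it contains an isochronous center family of period $2\pi/|\omega_2|$. 3) Let $\omega_3/\omega_2\in\mathbb N$. If $\bar r=0$, there are infinitely many $y$-invariant holomorphic center manifolds at the origin, each of which contains an isochronous center family of period $2\pi/|\omega_2|$. If $\bar r\ne0$, there are none. 4) If $\omega_2/\omega_1\notin\mathbb N$ and $\omega_3/\omega_1\notin\mathbb N$, there is exactly one $x$-invariant holomorphic center manifold at the origin, and it contains an isochronous center family of period $2\pi/|\omega_1|$. 5) Let $\omega_2/\omega_1\in\mathbb N$ and $\omega_3/\omega_1\notin\mathbb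 N$. If $\bar p=0$, there are infinitely many $x$-invariant holomorphic center manifolds at the origin, each of which contains an isochronous center family of period $2\pi/|\omega_1|$. If $\bar p\ne0$, there are none. 6) Let $\omega_2/\omega_1\notin\mathbb N$ and $\omega_3/\omega_1\in\mathbb N$. If $\hat r=0$, there are infinitely many $x$-invariant holomorphic center manifolds at the origin, each of which contains an isochronous center family of period $2\pi/|\omega_1|$. If $\hat r\ne0$, there are none. 7) Let $\omega_2/\omega_1\in\mathbb N$ and $\omega_3/\omega_1\in\mathbb N$. If $\bar p=0$ and $\hat r(c)=0$ for some $c\in\mathbb C$, there are infinitely many $x$-invariant holomorphic center manifolds at the origin, each of which contains an isochronous center family of period $2\pi/|\omega_1|$. If $\bar p\ne0$, or $\bar p=0$ and $\hat r(c)\ne0$ for all $c\in\mathbb C$, there are none. -/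

import Mathlib

open scoped Topology

noncomputable section

/-- The phase space, with coordinates `x = w 0`, `y = w 1`, `z = w 2`. -/
abbrev PhaseSpace : Type := Fin 3 → ℂ

/-- `M` is a holomorphic center manifold at the origin, tangent to the `k`-th coordinate axis, of the
system `w' = F w` (real time) on the open set `U`: it is the graph over a disc of the `k`-th axis of a
holomorphic map vanishing to second order at `0`, and it is locally invariant, that is, through each of
its points there passes a solution which stays in `M` for all small positive and negative times. -/
def IsHolomorphicCenterManifold (F : PhaseSpace → PhaseSpace) (U : Set PhaseSpace) (k : Fin 3)
    (M : Set PhaseSpace) : Prop :=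
  (∃ ρ : ℝ, 0 < ρ ∧ ∃ γ : ℂ → PhaseSpace,
    AnalyticOnNhd ℂ γ (Metric.ball 0 ρ) ∧
    (∀ t ∈ Metric.ball (0 : ℂ) ρ, γ t k = t) ∧
    γ 0 = 0 ∧ deriv γ 0 = Pi.single k 1 ∧
    M = γ '' Metric.ball 0 ρ) ∧
  M ⊆ U ∧
  ∀ p ∈ M, ∃ ε : ℝ, 0 < ε ∧ ∃ c : ℝ → PhaseSpace, c 0 = p ∧
    ∀ t ∈ Set.Ioo (-ε) ε, HasDerivAt c (F (c t)) t ∧ c t ∈ M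

/-- `M` contains an isochronous center family of period `T` around the origin: all points of `M` other
than the origin which are close enough to the origin lie on periodic orbits of `w' = F w` that are
contained in `M`, as close to the origin as desired, and have the same minimal period `T`. -/
def ContainsIsochronousCenterFamily (F : PhaseSpace → PhaseSpace) (M : Set PhaseSpace) (T : ℝ) :
    Prop :=
  0 < T ∧ ∀ V ∈ 𝓝 (0 : PhaseSpace), ∃ V' ∈ 𝓝 (0 : PhaseSpace), ∀ p ∈ M ∩ V', p ≠ 0 →
    ∃ c : ℝ → PhaseSpace, c 0 = p ∧ (∀ t, HasDerivAt c (F (c t)) t) ∧ (∀ t, c t ∈ M ∩ V) ∧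
      Function.Periodic c T ∧ ∀ t, 0 < t → t < T → c t ≠ p

/-- There is exactly one holomorphic center manifold tangent to the `k`-th axis, where two of them are
identified if they agree near the origin, and it contains an isochronous center family of period `T`. -/
def HasOneCenterManifold (F : PhaseSpace → PhaseSpace) (U : Set PhaseSpace) (k : Fin 3) (T : ℝ) :
    Prop :=
  ∃ M, IsHolomorphicCenterManifold F U k M ∧ ContainsIsochronousCenterFamily F M T ∧
    ∀ M', IsHolomorphicCenterManifold F U k M' → M' =ᶠ[𝓝 (0 : PhaseSpace)] M

/-- There are infinitely many holomorphic center manifolds tangent to the `k`-th axis, no two of which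
agree near the origin, and every holomorphic center manifold tangent to the `k`-th axis contains an
isochronous center family of period `T`. -/
def HasInfinitelyManyCenterManifolds (F : PhaseSpace → PhaseSpace) (U : Set PhaseSpace) (k : Fin 3)
    (T : ℝ) : Prop :=
  (∃ M : ℕ → Set PhaseSpace, (∀ n, IsHolomorphicCenterManifold F U k (M n)) ∧
    Pairwise fun m n => ¬ (M m =ᶠ[𝓝 (0 : PhaseSpace)] M n)) ∧
  ∀ M, IsHolomorphicCenterManifold F U k M → ContainsIsochronousCenterFamily F M T

/-- There is no holomorphic center manifold tangent to the `k`-th axis. -/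
def HasNoCenterManifold (F : PhaseSpace → PhaseSpace) (U : Set PhaseSpace) (k : Fin 3) : Prop :=
  ∀ M, ¬ IsHolomorphicCenterManifold F U k M

/-- A two-dimensional Briot-Bouquet system `t u' = f (t, u, v)`, `t v' = g (t, u, v)`, given by its
right-hand sides. -/
structure BriotBouquetSystem where
  f : ℂ → ℂ → ℂ → ℂ
  g : ℂ → ℂ → ℂ → ℂ

namespace BriotBouquetSystem

/-- The coefficient `p` of the linear part `t u' = p t + q u + ⋯`, `t v' = r t + s v + ⋯`. -/
def p (S : BriotBouquetSystem) : ℂ := deriv (fun t => S.f t 0 0) 0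

/-- The coefficient `q` of the linear part. -/
def q (S : BriotBouquetSystem) : ℂ := deriv (fun u => S.f 0 u 0) 0

/-- The coefficient `r` of the linear part. -/
def r (S : BriotBouquetSystem) : ℂ := deriv (fun t => S.g t 0 0) 0

/-- The coefficient `s` of the linear part. -/
def s (S : BriotBouquetSystem) : ℂ := deriv (fun v => S.g 0 0 v) 0

/-- The system satisfied by the new unknowns `u₁`, `v₁` after the change of variables
`u = t (u₁ + a)`, `v = t (v₁ + b)`, namely
`t u₁' = f (t, t (u₁ + a), t (v₁ + b)) / t - (u₁ + a)` and likewise for `v₁`. Here `dslope` is the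
quotient by `t` for `t ≠ 0` and its limit for `t = 0` (recall that `f` and `g` vanish at `0`). -/
def step (S : BriotBouquetSystem) (a b : ℂ) : BriotBouquetSystem where
  f := fun t u v => dslope (fun τ => S.f τ (τ * (u + a)) (τ * (v + b))) 0 t - (u + a)
  g := fun t u v => dslope (fun τ => S.g τ (τ * (u + a)) (τ * (v + b))) 0 t - (v + b)

open Classical in
/-- The change of variables `u = t (u₁ + p / (1 - q))`, `v = t (v₁ + r / (1 - s))`. If `q = 1`, the
value `u' (0)` is not determined by the equation (which requires `p = 0`), and the free constant `c` is
used in place of `p / (1 - q)`. (The transformation is not used for systems with `s = 1`.) -/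
def next (c : ℂ) (S : BriotBouquetSystem) : BriotBouquetSystem :=
  S.step (if S.q = 1 then c else S.p / (1 - S.q)) (S.r / (1 - S.s))

/-- The system after `n` successive changes of variables. The constant `c` plays a role only if a
system with `q = 1` is met on the way. -/
def reduce (c : ℂ) (n : ℕ) (S : BriotBouquetSystem) : BriotBouquetSystem :=
  (next c)^[n] S

end BriotBouquetSystem

/-- For `{k, i, j} = {0, 1, 2}`: the Briot-Bouquet system which expresses that the curve with `k`-th
coordinate `t`, `i`-th coordinate `t * u t` and `j`-th coordinate `t * v t` is invariant under
`w' = F w`, that is,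
`t u' = Fᵢ / Fₖ - u` and `t v' = Fⱼ / Fₖ - v`, where `F` is evaluated along the curve (both components
of the quotients are divided by `t`, so that they make sense for `t = 0` too). -/
def briotBouquetOf (F : PhaseSpace → PhaseSpace) (k i j : Fin 3) : BriotBouquetSystem where
  f := fun t u v =>
    dslope (fun τ => F (Pi.single k τ + Pi.single i (τ * u) + Pi.single j (τ * v)) i) 0 t /
      dslope (fun τ => F (Pi.single k τ + Pi.single i (τ * u) + Pi.single j (τ * v)) k) 0 t - u
  g := fun t u v =>
    dslope (fun τ => F (Pi.single k τ + Pi.single i (τ * u) + Pi.single j (τ * v)) j) 0 t /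
      dslope (fun τ => F (Pi.single k τ + Pi.single i (τ * u) + Pi.single j (τ * v)) k) 0 t - v

end

/-! A real-time solution `c` lying on a graph over the `k`-th axis satisfies `c = γ ∘ c_k`, so
differentiating at time `0` gives the tangency equation `F(γ) = F_k(γ) γ'`. Tangency to the axis
allows one to write `γ` as `(t, t u, t v)` with `u(0) = v(0) = 0`, and the equation becomes the
Briot–Bouquet system with `q = ω_i/ω_k - 1`, `s = ω_j/ω_k - 1`. Conversely, on a curve satisfying
the tangency equation the field reduces to the scalar field `F_k(γ(t))`, which has a simple zero
with derivative `i ω_k`. Such a field is holomorphically linearizable, hence conjugate to a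
rotation: this yields at once local invariance, closed orbits and the minimal period `2π/|ω_k|`.
Only the count of solution germs with `u(0) = v(0) = 0` remains.

A solution satisfies `p + q u'(0) = u'(0)` and `r + s v'(0) = v'(0)`. Unless `q` or `s` is `1` these
values are forced, and a reduction step lowers `q` and `s` by one without changing the number of
solutions. If neither is a positive integer, enough steps lead to `q, s ≤ -1`. There the system
reads `t u' + α u = N₁`, `t v' + β v = N₂` with `α, β ≥ 1` and `N₁, N₂` small Lipschitz in the
unknowns; the Euler operators on the left are inverted by integrals of norm at most one, so a
contraction argument gives exactly one solution (`IsRegular.hasUniqueSolution`).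

At an eigenvalue `1` the coefficient of `t` is an obstruction: if nonzero there is no solution, if
zero the first derivative is free, and each choice leaves a system with that eigenvalue equal to
`0`. This settles a single resonance. If both eigenvalues are positive integers, the one from `ω₂`
reaches `1` first; its free constant `c` is carried along to the second obstruction, which has to
vanish for some `c` (`IsRegular.resonance_both`). Ratios with the larger frequency in the
denominator never resonate, since they give eigenvalues at most `0`. -/

/-! ### Division of analytic functions by a scalar parameter. -/

/-- Hadamard's lemma for analytic functions. -/
theorem AnalyticAt.exists_eq_apply_self {E G : Type*} [NormedAddCommGroup E] [NormedSpace ℂ E]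
    [NormedAddCommGroup G] [NormedSpace ℂ G] [CompleteSpace G] {h : E → G}
    (hh : AnalyticAt ℂ h 0) (h0 : h 0 = 0) :
    ∃ A : E → E →L[ℂ] G, AnalyticAt ℂ A 0 ∧ A 0 = fderiv ℂ h 0 ∧ ∀ᶠ w in 𝓝 0, h w = A w w := by
  obtain ⟨p, r, hp⟩ := hh
  -- `A` is the sum of the shifted series: splitting one argument off each term of degree `n + 1`
  -- leaves a term of degree `n` with values in linear maps, and the constant term is `h 0 = 0`.
  have hrad : 0 < p.shift.radius := by
    rw [FormalMultilinearSeries.radius_shift]; exact hp.r_pos.trans_le hp.r_le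
  have hA := p.shift.hasFPowerSeriesOnBall hrad
  have heq : ∀ᶠ w in 𝓝 (0 : E), h w = p.shift.sum w w := by
    filter_upwards [Metric.eball_mem_nhds (0 : E) hp.r_pos] with w hw
    have h1 := hp.hasSum hw
    have h2 := hA.hasSum (y := w)
      (by rw [FormalMultilinearSeries.radius_shift]; exact Metric.eball_subset_eball hp.r_le hw)
    have h3 := h2.mapL (ContinuousLinearMap.apply ℂ G w)
    rw [← hasSum_nat_add_iff' 1] at h1
    have h4 : p 0 (fun _ => w) = 0 := by
      rw [← h0, ← hp.coeff_zero (fun _ => w)]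
    simp only [zero_add, Finset.sum_range_one, h4, sub_zero] at h1
    refine h1.unique ?_
    convert h3 using 2 with n
    · simp only [FormalMultilinearSeries.shift, ContinuousLinearMap.apply_apply]
      rw [ContinuousMultilinearMap.curryRight_apply]
      congr 1
      ext i
      refine Fin.lastCases ?_ (fun j => ?_) i <;> simp
    · simp
  refine ⟨p.shift.sum, hA.analyticAt, ?_, heq⟩
  -- In the product rule the term containing the derivative of `A` is applied to the vector `0`, so
  -- only `A 0` survives.
  have h1 : HasFDerivAt (fun w => p.shift.sum w w) _ 0 :=
    hA.analyticAt.differentiableAt.hasFDerivAt.clm_apply (hasFDerivAt_id (0 : E))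
  have h2 := (h1.congr_of_eventuallyEq heq).fderiv
  rw [h2]
  ext x
  simp

/-- The quotient of an analytic function by a scalar parameter, along rays, is jointly analytic. -/
theorem AnalyticAt.dslope_ray {E G : Type*} [NormedAddCommGroup E] [NormedSpace ℂ E]
    [NormedAddCommGroup G] [NormedSpace ℂ G] [CompleteSpace G] {h : E → G}
    (hh : AnalyticAt ℂ h 0) (h0 : h 0 = 0) (e₀ : E) :
    AnalyticAt ℂ (fun x : ℂ × E => dslope (fun τ : ℂ => h (τ • x.2)) 0 x.1) (0, e₀) := by
  obtain ⟨A, hA, hA0, heq⟩ := hh.exists_eq_apply_self h0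
  have hm : AnalyticAt ℂ (fun x : ℂ × E => x.1 • x.2) (0, e₀) := analyticAt_fst.smul analyticAt_snd
  have hA' : AnalyticAt ℂ (fun x : ℂ × E => A (x.1 • x.2)) (0, e₀) := by
    refine AnalyticAt.fun_comp (f := fun x : ℂ × E => x.1 • x.2) ?_ hm
    simpa using hA
  -- From `h w = A w w` the quotient `h (t e) / t` is `A (t e) e`, which is analytic across `t = 0`
  -- as well.
  have h1 : AnalyticAt ℂ (fun x : ℂ × E => A (x.1 • x.2) x.2) (0, e₀) :=
    AnalyticAt.comp₂ ((ContinuousLinearMap.id ℂ (E →L[ℂ] G)).analyticAt_bilinear _) hA' analyticAt_snd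
  refine h1.congr ?_
  have h2 : ∀ᶠ x : ℂ × E in 𝓝 (0, e₀), h (x.1 • x.2) = A (x.1 • x.2) (x.1 • x.2) := by
    have := hm.continuousAt
    refine this.eventually (p := fun w => h w = A w w) ?_
    simpa using heq
  filter_upwards [h2] with x hx
  by_cases ht : x.1 = 0
  · rw [ht, dslope_same]
    have h3 : HasDerivAt (fun τ : ℂ => h (τ • x.2)) (fderiv ℂ h 0 x.2) 0 := by
      have h4 : HasDerivAt (fun τ : ℂ => τ • x.2) ((1 : ℂ) • x.2) 0 :=
        (hasDerivAt_id (0 : ℂ)).smul_const x.2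
      rw [one_smul] at h4
      refine HasFDerivAt.comp_hasDerivAt (0 : ℂ) (l := h) ?_ h4
      simpa using hh.differentiableAt.hasFDerivAt
    rw [h3.deriv]
    simp [hA0]
  · rw [dslope_of_ne _ ht, slope_def_module]
    simp [hx, h0, ht]

theorem dslope_ray_zero {E G : Type*} [NormedAddCommGroup E] [NormedSpace ℂ E]
    [NormedAddCommGroup G] [NormedSpace ℂ G] {h : E → G}
    (hh : DifferentiableAt ℂ h 0) (e : E) :
    dslope (fun τ : ℂ => h (τ • e)) 0 0 = fderiv ℂ h 0 e := by
  rw [dslope_same]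
  have h4 : HasDerivAt (fun τ : ℂ => τ • e) ((1 : ℂ) • e) 0 :=
    (hasDerivAt_id (0 : ℂ)).smul_const e
  rw [one_smul] at h4
  refine (HasFDerivAt.comp_hasDerivAt (0 : ℂ) (l := h) ?_ h4).deriv
  simpa using hh.hasFDerivAt

/-! ### Linear parts and the reduction step. -/

namespace BriotBouquetSystem

/-- The system is holomorphic near the origin, vanishes there, and its linear part in the unknowns is
diagonal with entries `q` and `s`. -/
structure IsRegular (S : BriotBouquetSystem) (q s : ℂ) : Prop where
  analyticAt_f : AnalyticAt ℂ (fun w : ℂ × ℂ × ℂ => S.f w.1 w.2.1 w.2.2) 0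
  analyticAt_g : AnalyticAt ℂ (fun w : ℂ × ℂ × ℂ => S.g w.1 w.2.1 w.2.2) 0
  f_zero : S.f 0 0 0 = 0
  g_zero : S.g 0 0 0 = 0
  fderiv_f : ∀ t u v,
    fderiv ℂ (fun w : ℂ × ℂ × ℂ => S.f w.1 w.2.1 w.2.2) 0 (t, u, v) = S.p * t + q * u
  fderiv_g : ∀ t u v,
    fderiv ℂ (fun w : ℂ × ℂ × ℂ => S.g w.1 w.2.1 w.2.2) 0 (t, u, v) = S.r * t + s * v

theorem hasDerivAt_curve {h : ℂ × ℂ × ℂ → ℂ} (hh : DifferentiableAt ℂ h 0) {α β γ : ℂ → ℂ}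
    {a b c : ℂ} (hα : HasDerivAt α a 0) (hβ : HasDerivAt β b 0) (hγ : HasDerivAt γ c 0)
    (hα0 : α 0 = 0) (hβ0 : β 0 = 0) (hγ0 : γ 0 = 0) :
    HasDerivAt (fun t => h (α t, β t, γ t)) (fderiv ℂ h 0 (a, b, c)) 0 := by
  refine HasFDerivAt.comp_hasDerivAt (0 : ℂ) (l := h) (f := fun t => (α t, β t, γ t)) ?_
    (hα.prodMk (hβ.prodMk hγ))
  rw [hα0, hβ0, hγ0]
  exact hh.hasFDerivAt

theorem fderiv_apply_eq {h : ℂ → ℂ → ℂ → ℂ}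
    (hh : DifferentiableAt ℂ (fun w : ℂ × ℂ × ℂ => h w.1 w.2.1 w.2.2) 0) (t u v : ℂ) :
    fderiv ℂ (fun w : ℂ × ℂ × ℂ => h w.1 w.2.1 w.2.2) 0 (t, u, v) =
      deriv (fun τ => h τ 0 0) 0 * t +
      fderiv ℂ (fun w : ℂ × ℂ × ℂ => h w.1 w.2.1 w.2.2) 0 (0, u, v) := by
  have h1 := hasDerivAt_curve hh (hasDerivAt_id (0 : ℂ)) (hasDerivAt_const (0 : ℂ) (0 : ℂ))
    (hasDerivAt_const (0 : ℂ) (0 : ℂ)) rfl rfl rfl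
  have h2 : deriv (fun τ => h τ 0 0) 0 = _ := h1.deriv
  have h3 : ((t, u, v) : ℂ × ℂ × ℂ) = t • ((1, 0, 0) : ℂ × ℂ × ℂ) + (0, u, v) := by simp
  rw [h3, map_add, map_smul, h2, smul_eq_mul, mul_comm]

/-- The slice `t = 0` determines the linear part except for the coefficient of `t`. Reduced systems
and invariance equations are affine in the unknowns on that slice, so their eigenvalues are read off
there. -/
theorem fderiv_apply_of_slice {h : ℂ → ℂ → ℂ → ℂ}
    (hh : DifferentiableAt ℂ (fun w : ℂ × ℂ × ℂ => h w.1 w.2.1 w.2.2) 0) {l : ℂ → ℂ → ℂ} {k : ℂ}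
    (hl : ∀ u v c, l (c * u) (c * v) = c * l u v)
    (hs : ∀ u v, h 0 u v = l u v + k) (t u v : ℂ) :
    fderiv ℂ (fun w : ℂ × ℂ × ℂ => h w.1 w.2.1 w.2.2) 0 (t, u, v) =
      deriv (fun τ => h τ 0 0) 0 * t + l u v := by
  rw [fderiv_apply_eq hh]
  congr 1
  have hu : HasDerivAt (fun t : ℂ => t * u) u 0 := by
    simpa using (hasDerivAt_id (0 : ℂ)).mul_const u
  have hv : HasDerivAt (fun t : ℂ => t * v) v 0 := by
    simpa using (hasDerivAt_id (0 : ℂ)).mul_const v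
  have h1 := hasDerivAt_curve hh (hasDerivAt_const (0 : ℂ) (0 : ℂ)) hu hv rfl (by simp) (by simp)
  refine h1.unique ?_
  simp only [hs, hl]
  simpa using ((hasDerivAt_id (0 : ℂ)).mul_const (l u v)).add_const k

theorem IsRegular.q_eq {S : BriotBouquetSystem} {q s : ℂ} (hS : S.IsRegular q s) : S.q = q := by
  have h1 := hasDerivAt_curve hS.analyticAt_f.differentiableAt (hasDerivAt_const (0 : ℂ) (0 : ℂ))
    (hasDerivAt_id (0 : ℂ)) (hasDerivAt_const (0 : ℂ) (0 : ℂ)) rfl rfl rfl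
  rw [hS.fderiv_f] at h1
  have h2 : S.q = _ := h1.deriv
  simpa using h2

theorem IsRegular.s_eq {S : BriotBouquetSystem} {q s : ℂ} (hS : S.IsRegular q s) : S.s = s := by
  have h1 := hasDerivAt_curve hS.analyticAt_g.differentiableAt (hasDerivAt_const (0 : ℂ) (0 : ℂ))
    (hasDerivAt_const (0 : ℂ) (0 : ℂ)) (hasDerivAt_id (0 : ℂ)) rfl rfl rfl
  rw [hS.fderiv_g] at h1
  have h2 : S.s = _ := h1.deriv
  simpa using h2

theorem analyticAt_dslope_step {h : ℂ → ℂ → ℂ → ℂ}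
    (hh : AnalyticAt ℂ (fun w : ℂ × ℂ × ℂ => h w.1 w.2.1 w.2.2) 0) (h0 : h 0 0 0 = 0) (a b : ℂ) :
    AnalyticAt ℂ (fun w : ℂ × ℂ × ℂ =>
      dslope (fun τ => h τ (τ * (w.2.1 + a)) (τ * (w.2.2 + b))) 0 w.1) 0 := by
  have h1 := hh.dslope_ray (by simpa using h0) (1, a, b)
  have h2 : AnalyticAt ℂ (fun w : ℂ × ℂ × ℂ =>
      ((w.1, ((1 : ℂ), w.2.1 + a, w.2.2 + b)) : ℂ × ℂ × ℂ × ℂ)) 0 := by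
    have hu : AnalyticAt ℂ (fun w : ℂ × ℂ × ℂ => w.2.1) 0 :=
      analyticAt_fst.fun_comp analyticAt_snd
    have hv : AnalyticAt ℂ (fun w : ℂ × ℂ × ℂ => w.2.2) 0 :=
      analyticAt_snd.fun_comp analyticAt_snd
    exact analyticAt_fst.prod (analyticAt_const.prod
      ((hu.add analyticAt_const).prod (hv.add analyticAt_const)))
  have h3 := AnalyticAt.fun_comp (f := fun w : ℂ × ℂ × ℂ =>
      ((w.1, ((1 : ℂ), w.2.1 + a, w.2.2 + b)) : ℂ × ℂ × ℂ × ℂ)) (x := 0) (by simpa using h1) h2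
  simpa using h3

theorem dslope_step_zero {h : ℂ → ℂ → ℂ → ℂ}
    (hh : AnalyticAt ℂ (fun w : ℂ × ℂ × ℂ => h w.1 w.2.1 w.2.2) 0) (u v : ℂ) :
    dslope (fun τ => h τ (τ * u) (τ * v)) 0 0 =
      fderiv ℂ (fun w : ℂ × ℂ × ℂ => h w.1 w.2.1 w.2.2) 0 (1, u, v) := by
  rw [← dslope_ray_zero hh.differentiableAt]
  simp

/-- At `t = 0` the new right-hand side is `p + q (u + a) - (u + a)`, whose constant term vanishes
exactly when `p + q a = a`. The condition is kept in this undivided form to include the resonant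
case `q = 1`, `p = 0` with arbitrary `a`. -/
theorem IsRegular.step {S : BriotBouquetSystem} {q s : ℂ} (hS : S.IsRegular q s) {a b : ℂ}
    (ha : S.p + q * a = a) (hb : S.r + s * b = b) : (S.step a b).IsRegular (q - 1) (s - 1) := by
  have hu : AnalyticAt ℂ (fun w : ℂ × ℂ × ℂ => w.2.1) 0 := analyticAt_fst.fun_comp analyticAt_snd
  have hv : AnalyticAt ℂ (fun w : ℂ × ℂ × ℂ => w.2.2) 0 := analyticAt_snd.fun_comp analyticAt_snd
  have hf : AnalyticAt ℂ (fun w : ℂ × ℂ × ℂ => (S.step a b).f w.1 w.2.1 w.2.2) 0 :=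
    (analyticAt_dslope_step hS.analyticAt_f hS.f_zero a b).sub (hu.add analyticAt_const)
  have hg : AnalyticAt ℂ (fun w : ℂ × ℂ × ℂ => (S.step a b).g w.1 w.2.1 w.2.2) 0 :=
    (analyticAt_dslope_step hS.analyticAt_g hS.g_zero a b).sub (hv.add analyticAt_const)
  have hf0 : ∀ u v, (S.step a b).f 0 u v = (q - 1) * u + 0 := by
    intro u v
    simp only [BriotBouquetSystem.step]
    rw [dslope_step_zero hS.analyticAt_f, hS.fderiv_f]
    linear_combination ha
  have hg0 : ∀ u v, (S.step a b).g 0 u v = (s - 1) * v + 0 := by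
    intro u v
    simp only [BriotBouquetSystem.step]
    rw [dslope_step_zero hS.analyticAt_g, hS.fderiv_g]
    linear_combination hb
  refine ⟨hf, hg, by simp [hf0], by simp [hg0], ?_, ?_⟩
  · exact fderiv_apply_of_slice hf.differentiableAt (l := fun u _ => (q - 1) * u)
      (fun u v c => by ring) hf0
  · exact fderiv_apply_of_slice hg.differentiableAt (l := fun _ v => (s - 1) * v)
      (fun u v c => by ring) hg0

end BriotBouquetSystem

/-! ### Solution germs and their behaviour under reduction. -/

namespace BriotBouquetSystem

/-- `(u, v)` is a holomorphic solution near the origin with `u 0 = v 0 = 0`. -/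
structure IsSolution (S : BriotBouquetSystem) (u v : ℂ → ℂ) : Prop where
  analyticAt_u : AnalyticAt ℂ u 0
  analyticAt_v : AnalyticAt ℂ v 0
  u_zero : u 0 = 0
  v_zero : v 0 = 0
  eq_f : ∀ᶠ t in 𝓝[≠] 0, t * deriv u t = S.f t (u t) (v t)
  eq_g : ∀ᶠ t in 𝓝[≠] 0, t * deriv v t = S.g t (u t) (v t)

/-- Any two solutions agree near the origin, and there is one. -/
def HasUniqueSolution (S : BriotBouquetSystem) : Prop :=
  ∃ u v, S.IsSolution u v ∧ ∀ u' v', S.IsSolution u' v' → u' =ᶠ[𝓝 0] u ∧ v' =ᶠ[𝓝 0] v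

/-- There are infinitely many solution germs. -/
def HasInfinitelyManySolutions (S : BriotBouquetSystem) : Prop :=
  ∃ u v : ℕ → ℂ → ℂ, (∀ n, S.IsSolution (u n) (v n)) ∧
    Pairwise fun m n => ¬ (u m =ᶠ[𝓝 0] u n ∧ v m =ᶠ[𝓝 0] v n)

/-- There is no solution germ. -/
def HasNoSolution (S : BriotBouquetSystem) : Prop := ∀ u v, ¬ S.IsSolution u v

/-- Divide the equation by `t` and let `t → 0`: the right-hand side becomes the slope of `h` along
the curve `(t, u, v)`. The separate function `y` lets this serve both equations. -/
theorem deriv_zero_eq {h : ℂ → ℂ → ℂ → ℂ} {u v y : ℂ → ℂ}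
    (hh : DifferentiableAt ℂ (fun w : ℂ × ℂ × ℂ => h w.1 w.2.1 w.2.2) 0) (h0 : h 0 0 0 = 0)
    (hu : DifferentiableAt ℂ u 0) (hv : DifferentiableAt ℂ v 0) (hu0 : u 0 = 0) (hv0 : v 0 = 0)
    (hy : AnalyticAt ℂ y 0) (heq : ∀ᶠ t in 𝓝[≠] 0, t * deriv y t = h t (u t) (v t)) :
    deriv y 0 =
      fderiv ℂ (fun w : ℂ × ℂ × ℂ => h w.1 w.2.1 w.2.2) 0 (1, deriv u 0, deriv v 0) := by
  have h1 := hasDerivAt_curve hh (hasDerivAt_id (0 : ℂ)) hu.hasDerivAt hv.hasDerivAt rfl hu0 hv0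
  rw [hasDerivAt_iff_tendsto_slope] at h1
  have h2 : Filter.Tendsto (deriv y) (𝓝[≠] 0) (𝓝 (deriv y 0)) :=
    hy.deriv.continuousAt.tendsto.mono_left nhdsWithin_le_nhds
  refine tendsto_nhds_unique (h2.congr' ?_) h1
  filter_upwards [heq, self_mem_nhdsWithin] with t ht ht0
  have ht0 : t ≠ 0 := ht0
  rw [slope_def_field]
  simp only [id, hu0, hv0, h0, sub_zero, ← ht]
  field_simp

theorem IsRegular.deriv_u {S : BriotBouquetSystem} {q s : ℂ} (hS : S.IsRegular q s) {u v : ℂ → ℂ}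
    (h : S.IsSolution u v) : S.p + q * deriv u 0 = deriv u 0 := by
  have := deriv_zero_eq hS.analyticAt_f.differentiableAt hS.f_zero h.analyticAt_u.differentiableAt
    h.analyticAt_v.differentiableAt h.u_zero h.v_zero h.analyticAt_u h.eq_f
  rw [hS.fderiv_f] at this
  rw [mul_one] at this
  exact this.symm

theorem IsRegular.deriv_v {S : BriotBouquetSystem} {q s : ℂ} (hS : S.IsRegular q s) {u v : ℂ → ℂ}
    (h : S.IsSolution u v) : S.r + s * deriv v 0 = deriv v 0 := by
  have := deriv_zero_eq hS.analyticAt_g.differentiableAt hS.g_zero h.analyticAt_u.differentiableAt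
    h.analyticAt_v.differentiableAt h.u_zero h.v_zero h.analyticAt_v h.eq_g
  rw [hS.fderiv_g] at this
  rw [mul_one] at this
  exact this.symm

theorem step_equation_iff {h : ℂ → ℂ → ℂ → ℂ} (h0 : h 0 0 0 = 0) {t a b u v u' : ℂ} (ht : t ≠ 0) :
    t * u' = dslope (fun τ => h τ (τ * (u + a)) (τ * (v + b))) 0 t - (u + a) ↔
      t * (u + a + t * u') = h t (t * (u + a)) (t * (v + b)) := by
  rw [dslope_of_ne _ ht, slope_def_field]
  simp only [zero_mul, h0, sub_zero]
  rw [eq_sub_iff_add_eq, eq_div_iff ht]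
  constructor <;> intro h <;> rw [← h] <;> ring

theorem hasDerivAt_mul_add {u : ℂ → ℂ} {t : ℂ} (hu : DifferentiableAt ℂ u t) (a : ℂ) :
    HasDerivAt (fun τ => τ * (u τ + a)) (u t + a + t * deriv u t) t := by
  simpa using (hasDerivAt_id t).fun_mul (hu.hasDerivAt.add_const a)

theorem eventually_differentiableAt {u : ℂ → ℂ} (hu : AnalyticAt ℂ u 0) :
    ∀ᶠ t in 𝓝[≠] 0, DifferentiableAt ℂ u t :=
  (hu.eventually_analyticAt.mono fun _ h => h.differentiableAt).filter_mono nhdsWithin_le_nhds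

theorem IsSolution.of_step {S : BriotBouquetSystem} (hf : S.f 0 0 0 = 0) (hg : S.g 0 0 0 = 0)
    {a b : ℂ} {u v : ℂ → ℂ} (h : (S.step a b).IsSolution u v) :
    S.IsSolution (fun t => t * (u t + a)) (fun t => t * (v t + b)) where
  analyticAt_u := analyticAt_id.mul (h.analyticAt_u.add analyticAt_const)
  analyticAt_v := analyticAt_id.mul (h.analyticAt_v.add analyticAt_const)
  u_zero := by simp
  v_zero := by simp
  eq_f := by
    filter_upwards [h.eq_f, self_mem_nhdsWithin, eventually_differentiableAt h.analyticAt_u]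
      with t ht ht0 hd
    rw [(hasDerivAt_mul_add hd a).deriv]
    refine (step_equation_iff hf ht0).1 ?_
    exact ht
  eq_g := by
    filter_upwards [h.eq_g, self_mem_nhdsWithin, eventually_differentiableAt h.analyticAt_v]
      with t ht ht0 hd
    rw [(hasDerivAt_mul_add hd b).deriv]
    -- Exchanging the unknowns turns the second equation into the form of the first.
    refine (step_equation_iff (h := fun t u v => S.g t v u) hg ht0).1 ?_
    exact ht

theorem exists_eq_mul_add {u : ℂ → ℂ} (hu : AnalyticAt ℂ u 0) (hu0 : u 0 = 0) :
    ∃ u₁ : ℂ → ℂ, AnalyticAt ℂ u₁ 0 ∧ u₁ 0 = 0 ∧ ∀ t, u t = t * (u₁ t + deriv u 0) := by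
  refine ⟨fun t => dslope u 0 t - deriv u 0, ?_, by simp, fun t => ?_⟩
  · obtain ⟨p, hp⟩ := hu
    exact hp.has_fpower_series_dslope_fslope.analyticAt.sub analyticAt_const
  · have := sub_smul_dslope u 0 t
    simp only [sub_zero, hu0, smul_eq_mul] at this
    simp [this]

theorem IsSolution.exists_step {S : BriotBouquetSystem} (hf : S.f 0 0 0 = 0) (hg : S.g 0 0 0 = 0)
    {u v : ℂ → ℂ} (h : S.IsSolution u v) :
    ∃ u₁ v₁ : ℂ → ℂ, (S.step (deriv u 0) (deriv v 0)).IsSolution u₁ v₁ ∧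
      (∀ t, u t = t * (u₁ t + deriv u 0)) ∧ ∀ t, v t = t * (v₁ t + deriv v 0) := by
  obtain ⟨u₁, hu₁, hu₁0, hu⟩ := exists_eq_mul_add h.analyticAt_u h.u_zero
  obtain ⟨v₁, hv₁, hv₁0, hv⟩ := exists_eq_mul_add h.analyticAt_v h.v_zero
  refine ⟨u₁, v₁, ⟨hu₁, hv₁, hu₁0, hv₁0, ?_, ?_⟩, hu, hv⟩
  · filter_upwards [h.eq_f, self_mem_nhdsWithin, eventually_differentiableAt hu₁]
      with t ht ht0 hd
    have h1 : deriv u t = u₁ t + deriv u 0 + t * deriv u₁ t := by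
      conv_lhs => rw [funext hu]
      exact (hasDerivAt_mul_add hd _).deriv
    rw [h1, hu t, hv t] at ht
    exact (step_equation_iff hf ht0).2 ht
  · filter_upwards [h.eq_g, self_mem_nhdsWithin, eventually_differentiableAt hv₁]
      with t ht ht0 hd
    have h1 : deriv v t = v₁ t + deriv v 0 + t * deriv v₁ t := by
      conv_lhs => rw [funext hv]
      exact (hasDerivAt_mul_add hd _).deriv
    rw [h1, hu t, hv t] at ht
    exact (step_equation_iff (h := fun t u v => S.g t v u) hg ht0).2 ht

/-- Cancelling `t` works only off `0`; the identity theorem recovers the full germ. -/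
theorem eventuallyEq_of_mul_add {u u' : ℂ → ℂ} (hu : AnalyticAt ℂ u 0) (hu' : AnalyticAt ℂ u' 0)
    {a : ℂ} (h : (fun t => t * (u t + a)) =ᶠ[𝓝 0] fun t => t * (u' t + a)) : u =ᶠ[𝓝 0] u' := by
  refine (hu.frequently_eq_iff_eventually_eq hu').1 (Filter.Eventually.frequently ?_)
  filter_upwards [h.filter_mono nhdsWithin_le_nhds, self_mem_nhdsWithin] with t ht ht0
  simpa using mul_left_cancel₀ ht0 ht

theorem HasInfinitelyManySolutions.of_step {S : BriotBouquetSystem} (hf : S.f 0 0 0 = 0)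
    (hg : S.g 0 0 0 = 0) {a b : ℂ} (h : (S.step a b).HasInfinitelyManySolutions) :
    S.HasInfinitelyManySolutions := by
  obtain ⟨u, v, hs, hne⟩ := h
  refine ⟨_, _, fun n => (hs n).of_step hf hg, fun m n hmn heq => hne hmn ⟨?_, ?_⟩⟩
  · exact eventuallyEq_of_mul_add (hs m).analyticAt_u (hs n).analyticAt_u heq.1
  · exact eventuallyEq_of_mul_add (hs m).analyticAt_v (hs n).analyticAt_v heq.2

theorem IsRegular.next_eq_step {S : BriotBouquetSystem} {q s : ℂ} (hS : S.IsRegular q s)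
    (hq : q ≠ 1) (c : ℂ) : S.next c = S.step (S.p / (1 - q)) (S.r / (1 - s)) := by
  rw [BriotBouquetSystem.next, hS.q_eq, hS.s_eq, if_neg hq]

theorem IsRegular.next_eq_step_free {S : BriotBouquetSystem} {s : ℂ} (hS : S.IsRegular 1 s)
    (c : ℂ) : S.next c = S.step c (S.r / (1 - s)) := by
  rw [BriotBouquetSystem.next, hS.q_eq, hS.s_eq, if_pos rfl]

theorem add_mul_eq_self_iff {p q a : ℂ} (hq : q ≠ 1) : p + q * a = a ↔ a = p / (1 - q) := by
  rw [eq_div_iff (sub_ne_zero.2 hq.symm)]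
  constructor <;> intro h <;> linear_combination -h

theorem IsRegular.next {S : BriotBouquetSystem} {q s : ℂ} (hS : S.IsRegular q s) (hq : q ≠ 1)
    (hs : s ≠ 1) (c : ℂ) : (S.next c).IsRegular (q - 1) (s - 1) := by
  rw [hS.next_eq_step hq]
  exact hS.step ((add_mul_eq_self_iff hq).2 rfl) ((add_mul_eq_self_iff hs).2 rfl)

theorem IsRegular.next_free {S : BriotBouquetSystem} {s : ℂ} (hS : S.IsRegular 1 s) (hp : S.p = 0)
    (hs : s ≠ 1) (c : ℂ) : (S.next c).IsRegular 0 (s - 1) := by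
  rw [hS.next_eq_step_free]
  simpa using hS.step (a := c) (by simp [hp]) ((add_mul_eq_self_iff hs).2 rfl)

/-- Away from resonance the derivatives at `0` are forced to be `p / (1 - q)` and `r / (1 - s)`, so
every solution passes through the step that `next` performs. -/
theorem IsRegular.exists_next {S : BriotBouquetSystem} {q s : ℂ} (hS : S.IsRegular q s)
    (hq : q ≠ 1) (hs : s ≠ 1) (c : ℂ) {u v : ℂ → ℂ} (h : S.IsSolution u v) :
    ∃ u₁ v₁ : ℂ → ℂ, (S.next c).IsSolution u₁ v₁ ∧
      (∀ t, u t = t * (u₁ t + S.p / (1 - q))) ∧ ∀ t, v t = t * (v₁ t + S.r / (1 - s)) := by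
  rw [hS.next_eq_step hq, ← (add_mul_eq_self_iff hq).1 (hS.deriv_u h),
    ← (add_mul_eq_self_iff hs).1 (hS.deriv_v h)]
  exact h.exists_step hS.f_zero hS.g_zero

theorem IsRegular.hasUniqueSolution_of_next {S : BriotBouquetSystem} {q s : ℂ}
    (hS : S.IsRegular q s) (hq : q ≠ 1) (hs : s ≠ 1) (c : ℂ)
    (h : (S.next c).HasUniqueSolution) : S.HasUniqueSolution := by
  obtain ⟨u, v, h1, h2⟩ := h
  rw [hS.next_eq_step hq] at h1
  refine ⟨_, _, h1.of_step hS.f_zero hS.g_zero, fun u' v' h' => ?_⟩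
  obtain ⟨u₁, v₁, h3, hu, hv⟩ := hS.exists_next hq hs c h'
  obtain ⟨h4, h5⟩ := h2 _ _ h3
  constructor
  · filter_upwards [h4] with t ht
    rw [hu, ht]
  · filter_upwards [h5] with t ht
    rw [hv, ht]

theorem IsRegular.hasInfinitelyManySolutions_of_next {S : BriotBouquetSystem} {q s : ℂ}
    (hS : S.IsRegular q s) {c : ℂ}
    (h : (S.next c).HasInfinitelyManySolutions) : S.HasInfinitelyManySolutions :=
  HasInfinitelyManySolutions.of_step hS.f_zero hS.g_zero h

theorem IsRegular.hasNoSolution_of_next {S : BriotBouquetSystem} {q s : ℂ}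
    (hS : S.IsRegular q s) (hq : q ≠ 1) (hs : s ≠ 1) (c : ℂ)
    (h : (S.next c).HasNoSolution) : S.HasNoSolution := by
  intro u v huv
  obtain ⟨u₁, v₁, h3, -⟩ := hS.exists_next hq hs c huv
  exact h _ _ h3

/-- A solution would survive the step whose free constant is its own `u'(0)`, which is why all `c`
have to be excluded. -/
theorem IsRegular.hasNoSolution_of_next_free {S : BriotBouquetSystem} {s : ℂ}
    (hS : S.IsRegular 1 s) (hs : s ≠ 1) (h : ∀ c, (S.next c).HasNoSolution) :
    S.HasNoSolution := by
  intro u v huv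
  obtain ⟨u₁, v₁, h3, -⟩ := huv.exists_step hS.f_zero hS.g_zero
  refine h (deriv u 0) u₁ v₁ ?_
  rwa [hS.next_eq_step_free, ← (add_mul_eq_self_iff hs).1 (hS.deriv_v huv)]

/-- For `q = 1` the relation `p + u'(0) = u'(0)` leaves no room for `p ≠ 0`. -/
theorem IsRegular.hasNoSolution_of_p_ne_zero {S : BriotBouquetSystem} {s : ℂ}
    (hS : S.IsRegular 1 s) (hp : S.p ≠ 0) : S.HasNoSolution := by
  intro u v h
  exact hp (by linear_combination hS.deriv_u h)

theorem IsRegular.hasNoSolution_of_r_ne_zero {S : BriotBouquetSystem} {q : ℂ}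
    (hS : S.IsRegular q 1) (hr : S.r ≠ 0) : S.HasNoSolution := by
  intro u v h
  exact hr (by linear_combination hS.deriv_v h)

theorem deriv_mul_add_zero {u : ℂ → ℂ} (hu : AnalyticAt ℂ u 0) (hu0 : u 0 = 0) (a : ℂ) :
    deriv (fun t => t * (u t + a)) 0 = a := by
  rw [(hasDerivAt_mul_add hu.differentiableAt a).deriv]
  simp [hu0]

/-- The step constant is `u'(0)`, so different constants give different germs; the natural numbers
suffice. -/
theorem IsRegular.hasInfinitelyManySolutions_of_step_left {S : BriotBouquetSystem} {q s b : ℂ}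
    (hS : S.IsRegular q s) (h : ∀ n : ℕ, ∃ u v, (S.step n b).IsSolution u v) :
    S.HasInfinitelyManySolutions := by
  choose u v h using h
  refine ⟨_, _, fun n => (h n).of_step hS.f_zero hS.g_zero, fun m n hmn heq => hmn ?_⟩
  have := heq.1.deriv_eq
  rw [deriv_mul_add_zero (h m).analyticAt_u (h m).u_zero,
    deriv_mul_add_zero (h n).analyticAt_u (h n).u_zero] at this
  exact_mod_cast this

theorem IsRegular.hasInfinitelyManySolutions_of_step_right {S : BriotBouquetSystem} {q s a : ℂ}
    (hS : S.IsRegular q s) (h : ∀ n : ℕ, ∃ u v, (S.step a n).IsSolution u v) :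
    S.HasInfinitelyManySolutions := by
  choose u v h using h
  refine ⟨_, _, fun n => (h n).of_step hS.f_zero hS.g_zero, fun m n hmn heq => hmn ?_⟩
  have := heq.2.deriv_eq
  rw [deriv_mul_add_zero (h m).analyticAt_v (h m).v_zero,
    deriv_mul_add_zero (h n).analyticAt_v (h n).v_zero] at this
  exact_mod_cast this

end BriotBouquetSystem

/-! ### Inverting the Euler operator `t d/dt + α`. -/

/-- The solution operator `w ↦ u` of the Euler equation `t u' + α u = w`. -/
noncomputable def eulerIntegral (α : ℝ) (w : ℂ → ℂ) (t : ℂ) : ℂ :=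
  ∫ s in (0 : ℝ)..1, ((s ^ (α - 1) : ℝ) : ℂ) * w (s * t)

theorem norm_ofReal_mul_le {s : ℝ} (hs : s ∈ Set.Icc (0 : ℝ) 1) (t : ℂ) : ‖(s : ℂ) * t‖ ≤ ‖t‖ := by
  rw [norm_mul, Complex.norm_real, Real.norm_of_nonneg hs.1]
  exact mul_le_of_le_one_left (norm_nonneg _) hs.2

theorem ofReal_mul_mem_ball {ρ : ℝ} {s : ℝ} (hs : s ∈ Set.Icc (0 : ℝ) 1) {t : ℂ}
    (ht : t ∈ Metric.ball (0 : ℂ) ρ) : (s : ℂ) * t ∈ Metric.ball (0 : ℂ) ρ := by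
  rw [mem_ball_zero_iff] at ht ⊢
  exact (norm_ofReal_mul_le hs t).trans_lt ht

/-- For `α ≥ 1` the weight `s ^ (α - 1)` is at most `1` on `[0, 1]`, so the operator does not
increase the supremum norm. The sharper factor `1/α` is not needed. -/
theorem norm_eulerIntegral_le {α : ℝ} (hα : 1 ≤ α) {w : ℂ → ℂ} {t : ℂ} {C : ℝ}
    (hw : ∀ s ∈ Set.Icc (0 : ℝ) 1, ‖w (s * t)‖ ≤ C) : ‖eulerIntegral α w t‖ ≤ C := by
  have h : ‖eulerIntegral α w t‖ ≤ C * |1 - 0| := by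
    refine intervalIntegral.norm_integral_le_of_norm_le_const fun s hs => ?_
    rw [Set.uIoc_of_le zero_le_one] at hs
    have hs' : s ∈ Set.Icc (0 : ℝ) 1 := ⟨hs.1.le, hs.2⟩
    rw [norm_mul, Complex.norm_real, Real.norm_of_nonneg (Real.rpow_nonneg hs'.1 _)]
    calc s ^ (α - 1) * ‖w (s * t)‖ ≤ 1 * ‖w (s * t)‖ :=
          mul_le_mul_of_nonneg_right (Real.rpow_le_one hs'.1 hs'.2 (by linarith)) (norm_nonneg _)
      _ ≤ C := by rw [one_mul]; exact hw s hs'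
  simpa using h

theorem continuousOn_comp_ofReal_mul {ρ : ℝ} {w : ℂ → ℂ}
    (hw : ContinuousOn w (Metric.ball 0 ρ)) {t : ℂ} (ht : t ∈ Metric.ball (0 : ℂ) ρ) :
    ContinuousOn (fun s : ℝ => w (s * t)) (Set.Icc 0 1) :=
  hw.comp (by fun_prop) fun _ hs => ofReal_mul_mem_ball hs ht

theorem continuous_ofReal_rpow {a : ℝ} (ha : 0 ≤ a) : Continuous fun s : ℝ => ((s ^ a : ℝ) : ℂ) :=
  Complex.continuous_ofReal.comp (Real.continuous_rpow_const ha)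

theorem intervalIntegrable_eulerIntegrand {α : ℝ} (hα : 1 ≤ α) {ρ : ℝ} {w : ℂ → ℂ}
    (hw : ContinuousOn w (Metric.ball 0 ρ)) {t : ℂ} (ht : t ∈ Metric.ball (0 : ℂ) ρ) :
    IntervalIntegrable (fun s : ℝ => ((s ^ (α - 1) : ℝ) : ℂ) * w (s * t)) MeasureTheory.volume 0 1 := by
  refine ContinuousOn.intervalIntegrable_of_Icc zero_le_one ?_
  exact (continuous_ofReal_rpow (by linarith)).continuousOn.mul (continuousOn_comp_ofReal_mul hw ht)

theorem norm_eulerIntegral_sub_le {α : ℝ} (hα : 1 ≤ α) {ρ : ℝ} {w w' : ℂ → ℂ}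
    (hw : ContinuousOn w (Metric.ball 0 ρ)) (hw' : ContinuousOn w' (Metric.ball 0 ρ))
    {t : ℂ} (ht : t ∈ Metric.ball (0 : ℂ) ρ) {C : ℝ}
    (hC : ∀ s ∈ Set.Icc (0 : ℝ) 1, ‖w (s * t) - w' (s * t)‖ ≤ C) :
    ‖eulerIntegral α w t - eulerIntegral α w' t‖ ≤ C := by
  have : eulerIntegral α w t - eulerIntegral α w' t = eulerIntegral α (fun z => w z - w' z) t := by
    rw [eulerIntegral, eulerIntegral, ← intervalIntegral.integral_sub
      (intervalIntegrable_eulerIntegrand hα hw ht) (intervalIntegrable_eulerIntegrand hα hw' ht)]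
    simp only [eulerIntegral, mul_sub]
  rw [this]
  exact norm_eulerIntegral_le hα hC

/-- The integrand is the `s`-derivative of `s ^ α * w (s t)`. This left inverse property drives
uniqueness. -/
theorem eulerIntegral_euler {α : ℝ} (hα : 1 ≤ α) {ρ : ℝ} {w : ℂ → ℂ}
    (hw : DifferentiableOn ℂ w (Metric.ball 0 ρ)) {t : ℂ} (ht : t ∈ Metric.ball (0 : ℂ) ρ) :
    eulerIntegral α (fun z => z * deriv w z + α * w z) t = w t := by
  have hd : ContinuousOn (fun z => z * deriv w z + α * w z) (Metric.ball 0 ρ) :=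
    (continuousOn_id.mul (hw.deriv Metric.isOpen_ball).continuousOn).add
      (continuousOn_const.mul hw.continuousOn)
  have hmul : ∀ s ∈ Set.Icc (0 : ℝ) 1, HasDerivAt (fun s : ℝ => ((s ^ α : ℝ) : ℂ) * w (s * t))
      (((s ^ (α - 1) : ℝ) : ℂ) * (s * t * deriv w (s * t) + α * w (s * t))) s := by
    intro s hs
    have h1 : HasDerivAt (fun s : ℝ => ((s ^ α : ℝ) : ℂ)) ((α * s ^ (α - 1) : ℝ) : ℂ) s :=
      (Real.hasDerivAt_rpow_const (Or.inr hα)).ofReal_comp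
    have h2 : HasDerivAt (fun s : ℝ => w (s * t)) (deriv w (s * t) * (1 * t)) s := by
      have h3 := (hw.differentiableAt
        (Metric.isOpen_ball.mem_nhds (ofReal_mul_mem_ball hs ht))).hasDerivAt
      exact h3.comp s ((Complex.ofRealCLM.hasDerivAt (x := s)).mul_const t)
    refine (h1.mul h2).congr_deriv ?_
    have h4 : s ^ α = s ^ (α - 1) * s := by
      rcases hs.1.eq_or_lt with h | h
      · rw [← h, Real.zero_rpow (by linarith), mul_zero]
      · rw [Real.rpow_sub_one h.ne', div_mul_cancel₀ _ h.ne']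
    rw [h4]
    push_cast
    ring
  have h5 := intervalIntegral.integral_eq_sub_of_hasDerivAt
    (fun s hs => hmul s (by rwa [Set.uIcc_of_le zero_le_one] at hs))
    (intervalIntegrable_eulerIntegrand hα hd ht)
  rw [eulerIntegral, h5, Real.zero_rpow (by linarith)]
  simp

theorem hasDerivAt_eulerIntegral {α : ℝ} (hα : 1 ≤ α) {ρ : ℝ} {w : ℂ → ℂ}
    (hw : DifferentiableOn ℂ w (Metric.ball 0 ρ)) {t : ℂ} (ht : t ∈ Metric.ball (0 : ℂ) ρ) :
    HasDerivAt (eulerIntegral α w)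
      (∫ s in (0 : ℝ)..1, ((s ^ (α - 1) : ℝ) : ℂ) * (s * deriv w (s * t))) t := by
  have hw' : ContinuousOn (deriv w) (Metric.ball 0 ρ) :=
    (hw.deriv Metric.isOpen_ball).continuousOn
  -- An intermediate radius gives a compact disc on which `w'` is bounded, which supplies the
  -- dominating constant.
  obtain ⟨r, hr, hrρ⟩ : ∃ r, ‖t‖ < r ∧ r < ρ := exists_between (mem_ball_zero_iff.1 ht)
  have hcl : Metric.closedBall (0 : ℂ) r ⊆ Metric.ball 0 ρ := Metric.closedBall_subset_ball hrρ
  obtain ⟨C, hC⟩ := (isCompact_closedBall (0 : ℂ) r).exists_bound_of_continuousOn (hw'.mono hcl)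
  have hball : Metric.ball (0 : ℂ) r ∈ 𝓝 t := Metric.isOpen_ball.mem_nhds (by simpa using hr)
  have hint : ∀ x ∈ Metric.ball (0 : ℂ) r, IntervalIntegrable
      (fun s : ℝ => ((s ^ (α - 1) : ℝ) : ℂ) * w (s * x)) MeasureTheory.volume 0 1 := fun x hx =>
    intervalIntegrable_eulerIntegrand hα hw.continuousOn (hcl (Metric.ball_subset_closedBall hx))
  refine (intervalIntegral.hasDerivAt_integral_of_dominated_loc_of_deriv_le
    (F := fun x (s : ℝ) => ((s ^ (α - 1) : ℝ) : ℂ) * w (s * x))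
    (F' := fun x (s : ℝ) => ((s ^ (α - 1) : ℝ) : ℂ) * (s * deriv w (s * x)))
    (bound := fun _ => C) hball ?_ (hint t (by simpa using hr)) ?_ ?_ ?_ ?_).2
  · filter_upwards [hball] with x hx
    exact (hint x hx).aestronglyMeasurable_restrict_uIoc
  · have : IntervalIntegrable (fun s : ℝ => ((s ^ (α - 1) : ℝ) : ℂ) * (s * deriv w (s * t)))
        MeasureTheory.volume 0 1 := by
      refine ContinuousOn.intervalIntegrable_of_Icc zero_le_one ?_
      exact (continuous_ofReal_rpow (by linarith)).continuousOn.mul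
        (Complex.continuous_ofReal.continuousOn.mul (continuousOn_comp_ofReal_mul hw' ht))
    exact this.aestronglyMeasurable_restrict_uIoc
  · refine Filter.Eventually.of_forall fun s hs x hx => ?_
    rw [Set.uIoc_of_le zero_le_one] at hs
    have hs' : s ∈ Set.Icc (0 : ℝ) 1 := ⟨hs.1.le, hs.2⟩
    rw [norm_mul, norm_mul, Complex.norm_real, Real.norm_of_nonneg (Real.rpow_nonneg hs'.1 _),
      Complex.norm_real, Real.norm_of_nonneg hs'.1]
    have h1 := hC _ (Metric.ball_subset_closedBall (ofReal_mul_mem_ball hs' hx))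
    have h2 : s ^ (α - 1) ≤ 1 := Real.rpow_le_one hs'.1 hs'.2 (by linarith)
    calc s ^ (α - 1) * (s * ‖deriv w (s * x)‖) ≤ 1 * (1 * ‖deriv w (s * x)‖) := by
          gcongr
          · exact mul_nonneg hs'.1 (norm_nonneg _)
          · exact hs'.2
      _ ≤ C := by simpa using h1
  · exact intervalIntegrable_const
  · refine Filter.Eventually.of_forall fun s hs x hx => ?_
    rw [Set.uIoc_of_le zero_le_one] at hs
    have hs' : s ∈ Set.Icc (0 : ℝ) 1 := ⟨hs.1.le, hs.2⟩
    have h3 := (hw.differentiableAt (Metric.isOpen_ball.mem_nhds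
      (ofReal_mul_mem_ball hs' (hcl (Metric.ball_subset_closedBall hx))))).hasDerivAt
    refine HasDerivAt.const_mul _ ?_
    refine (h3.comp x ((hasDerivAt_id x).const_mul (s : ℂ))).congr_deriv ?_
    simp [mul_comm]

/-- Differentiation under the integral shows that the Euler operator commutes with the integral, so
the left inverse is also a right inverse. This is the property used for existence. -/
theorem mul_deriv_eulerIntegral {α : ℝ} (hα : 1 ≤ α) {ρ : ℝ} {w : ℂ → ℂ}
    (hw : DifferentiableOn ℂ w (Metric.ball 0 ρ)) {t : ℂ} (ht : t ∈ Metric.ball (0 : ℂ) ρ) :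
    t * deriv (eulerIntegral α w) t + α * eulerIntegral α w t = w t := by
  rw [(hasDerivAt_eulerIntegral hα hw ht).deriv]
  conv_rhs => rw [← eulerIntegral_euler hα hw ht]
  have hw' : ContinuousOn (deriv w) (Metric.ball 0 ρ) :=
    (hw.deriv Metric.isOpen_ball).continuousOn
  rw [eulerIntegral, eulerIntegral, ← intervalIntegral.integral_const_mul,
    ← intervalIntegral.integral_const_mul, ← intervalIntegral.integral_add]
  · exact intervalIntegral.integral_congr fun s _ => by ring
  · refine (ContinuousOn.intervalIntegrable_of_Icc zero_le_one ?_).const_mul _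
    exact (continuous_ofReal_rpow (by linarith)).continuousOn.mul
        (Complex.continuous_ofReal.continuousOn.mul (continuousOn_comp_ofReal_mul hw' ht))
  · exact (intervalIntegrable_eulerIntegrand hα hw.continuousOn ht).const_mul _

/-! ### Contraction and Lipschitz estimates. -/

/-- A contraction of a space of bounded holomorphic functions on a disc has a fixed point. -/
theorem exists_holomorphic_fixedPoint {X : Type*} [NormedAddCommGroup X] [NormedSpace ℂ X]
    [CompleteSpace X] {ρ δ : ℝ} (hρ : 0 < ρ) (hδ : 0 ≤ δ) (D : Set (ℂ → X))
    (hD : D = {x | DifferentiableOn ℂ x (Metric.ball 0 ρ) ∧ x 0 = 0 ∧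
      ∀ t ∈ Metric.ball (0 : ℂ) ρ, ‖x t‖ ≤ δ})
    (T : (ℂ → X) → ℂ → X) (hT : ∀ x ∈ D, T x ∈ D)
    (hL : ∀ x ∈ D, ∀ y ∈ D, ∀ C, (∀ t ∈ Metric.ball (0 : ℂ) ρ, ‖x t - y t‖ ≤ C) →
      ∀ t ∈ Metric.ball (0 : ℂ) ρ, ‖T x t - T y t‖ ≤ C / 2) :
    ∃ x ∈ D, ∀ t ∈ Metric.ball (0 : ℂ) ρ, T x t = x t := by
  have h0 : (fun _ => 0) ∈ D := by
    rw [hD]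
    exact ⟨differentiableOn_const _, rfl, fun t _ => by simpa using hδ⟩
  set x : ℕ → ℂ → X := fun n => T^[n] (fun _ => 0) with hx
  have hsucc : ∀ n, x (n + 1) = T (x n) := fun n => Function.iterate_succ_apply' _ _ _
  have hxD : ∀ n, x n ∈ D := by
    intro n
    induction n with
    | zero => exact h0
    | succ n ih => rw [hsucc]; exact hT _ ih
  -- The first Picard step has length at most `δ` and each further one is halved; `2 * δ / 2 / 2 ^
  -- n` is the shape the geometric series lemmas expect.
  have hstep : ∀ n, ∀ t ∈ Metric.ball (0 : ℂ) ρ, dist (x n t) (x (n + 1) t) ≤ 2 * δ / 2 / 2 ^ n := by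
    intro n
    induction n with
    | zero =>
      intro t ht
      have h1 := hxD 1
      rw [hD] at h1
      simpa [hx] using h1.2.2 t ht
    | succ n ih =>
      intro t ht
      rw [dist_eq_norm]
      have e1 : x (n + 1) t = T (x n) t := by rw [hsucc]
      have e2 : x (n + 1 + 1) t = T (x (n + 1)) t := by rw [hsucc]
      rw [e1, e2]
      refine (hL _ (hxD n) _ (hxD (n + 1)) (2 * δ / 2 / 2 ^ n) ?_ t ht).trans_eq ?_
      · intro z hz
        rw [← dist_eq_norm]
        exact ih z hz
      · rw [pow_succ]; ring
  have hlim : ∀ t, ∃ y, t ∈ Metric.ball (0 : ℂ) ρ → Filter.Tendsto (fun n => x n t) Filter.atTop (𝓝 y) := by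
    intro t
    by_cases ht : t ∈ Metric.ball (0 : ℂ) ρ
    · obtain ⟨y, hy⟩ := cauchySeq_tendsto_of_complete
        (cauchySeq_of_le_geometric_two (f := fun n => x n t) (C := 2 * δ) fun n => hstep n t ht)
      exact ⟨y, fun _ => hy⟩
    · exact ⟨0, fun h => (ht h).elim⟩
  choose y hy using hlim
  have hdist : ∀ n, ∀ t ∈ Metric.ball (0 : ℂ) ρ, dist (x n t) (y t) ≤ 2 * δ / 2 ^ n := fun n t ht =>
    dist_le_of_le_geometric_two_of_tendsto (f := fun n => x n t) (fun n => hstep n t ht) (hy t ht) n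
  have hzero : Filter.Tendsto (fun n : ℕ => 2 * δ / 2 ^ n) Filter.atTop (𝓝 0) :=
    tendsto_const_nhds.div_atTop (tendsto_pow_atTop_atTop_of_one_lt one_lt_two)
  have hunif : TendstoUniformlyOn x y Filter.atTop (Metric.ball 0 ρ) := by
    rw [Metric.tendstoUniformlyOn_iff]
    intro ε hε
    filter_upwards [hzero.eventually (gt_mem_nhds hε)] with n hn t ht
    rw [dist_comm]
    exact (hdist n t ht).trans_lt hn
  have hmem : ∀ n, DifferentiableOn ℂ (x n) (Metric.ball 0 ρ) ∧ x n 0 = 0 ∧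
      ∀ t ∈ Metric.ball (0 : ℂ) ρ, ‖x n t‖ ≤ δ := fun n => by
    have := hxD n
    rw [hD] at this
    exact this
  -- By Weierstrass, the locally uniform limit of the iterates is again holomorphic.
  have hyD : y ∈ D := by
    rw [hD]
    refine ⟨hunif.tendstoLocallyUniformlyOn.differentiableOn
      (Filter.Eventually.of_forall fun n => (hmem n).1) Metric.isOpen_ball, ?_, fun t ht => ?_⟩
    · refine tendsto_nhds_unique (hy 0 (Metric.mem_ball_self hρ)) ?_
      simp only [(hmem _).2.1, tendsto_const_nhds]
    · exact le_of_tendsto (hy t ht).norm (Filter.Eventually.of_forall fun n => (hmem n).2.2 t ht)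
  refine ⟨y, hyD, fun t ht => ?_⟩
  refine tendsto_nhds_unique ?_ ((hy t ht).comp (Filter.tendsto_add_atTop_nat 1))
  rw [tendsto_iff_dist_tendsto_zero]
  refine squeeze_zero (fun _ => dist_nonneg) (fun n => ?_)
    (show Filter.Tendsto (fun n : ℕ => 2 * δ / 2 ^ n / 2) _ (𝓝 0) by simpa using hzero.div_const 2)
  have e1 : x (n + 1) t = T (x n) t := by rw [hsucc]
  rw [Function.comp_apply, e1, dist_eq_norm]
  refine hL _ (hxD n) _ hyD _ (fun z hz => ?_) t ht
  rw [← dist_eq_norm]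
  exact hdist n z hz

/-- Strict differentiability makes `h` differ from its derivative by a map with Lipschitz constant
`1/2` near `0`, and the derivative vanishes on differences `(0, x - y)`. -/
theorem AnalyticAt.exists_lipschitz_snd {E : Type*} [NormedAddCommGroup E] [NormedSpace ℂ E]
    {h : ℂ × E → ℂ} (hh : AnalyticAt ℂ h 0) (hd : ∀ x : E, fderiv ℂ h 0 (0, x) = 0) :
    ∃ R > 0, (∀ w ∈ Metric.ball 0 R, DifferentiableAt ℂ h w) ∧
      ∀ t : ℂ, ∀ x y : E, ‖t‖ < R → ‖x‖ < R → ‖y‖ < R → ‖h (t, x) - h (t, y)‖ ≤ ‖x - y‖ / 2 := by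
  obtain ⟨R₁, hR₁, h1⟩ := Metric.eventually_nhds_iff_ball.1 hh.eventually_analyticAt
  have h2 := hh.hasStrictFDerivAt.isLittleO.def (show (0 : ℝ) < 1 / 2 by norm_num)
  obtain ⟨R₂, hR₂, h2⟩ := Metric.eventually_nhds_iff_ball.1 h2
  refine ⟨min R₁ R₂, lt_min hR₁ hR₂, fun w hw =>
    (h1 w (Metric.ball_subset_ball (min_le_left _ _) hw)).differentiableAt, fun t x y ht hx hy => ?_⟩
  have ht := ht.trans_le (min_le_right R₁ R₂)
  have hx := hx.trans_le (min_le_right R₁ R₂)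
  have hy := hy.trans_le (min_le_right R₁ R₂)
  have h3 := h2 ((t, x), (t, y)) (by simp [Prod.dist_eq, *])
  have h4 : ((t, x) : ℂ × E) - (t, y) = (0, x - y) := by simp
  rw [h4, hd, sub_zero] at h3
  refine h3.trans_eq ?_
  simp [Prod.norm_def]
  ring

/-! ### The Briot–Bouquet theorem. -/

namespace BriotBouquetSystem

theorem IsRegular.exists_lipschitz {S : BriotBouquetSystem} {α β : ℝ}
    (hS : S.IsRegular (-α) (-β)) : ∃ R > 0,
    (∀ w ∈ Metric.ball (0 : ℂ × ℂ × ℂ) R,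
      DifferentiableAt ℂ (fun w : ℂ × ℂ × ℂ => S.f w.1 w.2.1 w.2.2 + α * w.2.1) w ∧
      DifferentiableAt ℂ (fun w : ℂ × ℂ × ℂ => S.g w.1 w.2.1 w.2.2 + β * w.2.2) w) ∧
    ∀ t : ℂ, ∀ x y : ℂ × ℂ, ‖t‖ < R → ‖x‖ < R → ‖y‖ < R →
      ‖(S.f t x.1 x.2 + α * x.1) - (S.f t y.1 y.2 + α * y.1)‖ ≤ ‖x - y‖ / 2 ∧
      ‖(S.g t x.1 x.2 + β * x.2) - (S.g t y.1 y.2 + β * y.2)‖ ≤ ‖x - y‖ / 2 := by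
  have hu : AnalyticAt ℂ (fun w : ℂ × ℂ × ℂ => w.2.1) 0 := analyticAt_fst.fun_comp analyticAt_snd
  have hv : AnalyticAt ℂ (fun w : ℂ × ℂ × ℂ => w.2.2) 0 := analyticAt_snd.fun_comp analyticAt_snd
  have hu' : HasFDerivAt (fun w : ℂ × ℂ × ℂ => (α : ℂ) * w.2.1)
      ((α : ℂ) • ((ContinuousLinearMap.fst ℂ ℂ ℂ).comp (ContinuousLinearMap.snd ℂ ℂ (ℂ × ℂ)))) 0 :=
    ((ContinuousLinearMap.fst ℂ ℂ ℂ).comp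
      (ContinuousLinearMap.snd ℂ ℂ (ℂ × ℂ))).hasFDerivAt.const_mul _
  have hv' : HasFDerivAt (fun w : ℂ × ℂ × ℂ => (β : ℂ) * w.2.2)
      ((β : ℂ) • ((ContinuousLinearMap.snd ℂ ℂ ℂ).comp (ContinuousLinearMap.snd ℂ ℂ (ℂ × ℂ)))) 0 :=
    ((ContinuousLinearMap.snd ℂ ℂ ℂ).comp
      (ContinuousLinearMap.snd ℂ ℂ (ℂ × ℂ))).hasFDerivAt.const_mul _
  obtain ⟨R₁, hR₁, h1, h2⟩ := AnalyticAt.exists_lipschitz_snd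
    (hS.analyticAt_f.fun_add (analyticAt_const.fun_mul hu)) (fun x => by
      rw [(hS.analyticAt_f.differentiableAt.hasFDerivAt.fun_add hu').fderiv]
      obtain ⟨a, b⟩ := x
      simp [hS.fderiv_f])
  obtain ⟨R₂, hR₂, h3, h4⟩ := AnalyticAt.exists_lipschitz_snd
    (hS.analyticAt_g.fun_add (analyticAt_const.fun_mul hv)) (fun x => by
      rw [(hS.analyticAt_g.differentiableAt.hasFDerivAt.fun_add hv').fderiv]
      obtain ⟨a, b⟩ := x
      simp [hS.fderiv_g])
  refine ⟨min R₁ R₂, lt_min hR₁ hR₂, fun w hw =>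
    ⟨h1 w (Metric.ball_subset_ball (min_le_left _ _) hw),
      h3 w (Metric.ball_subset_ball (min_le_right _ _) hw)⟩, fun t x y ht hx hy => ⟨?_, ?_⟩⟩
  · exact h2 t x y (ht.trans_le (min_le_left _ _)) (hx.trans_le (min_le_left _ _))
      (hy.trans_le (min_le_left _ _))
  · exact h4 t x y (ht.trans_le (min_le_right _ _)) (hx.trans_le (min_le_right _ _))
      (hy.trans_le (min_le_right _ _))

/-- Solutions are fixed points of the map applying the Euler integrals to the remainders `N₁ = f + α
u` and `N₂ = g + β v`, which have no linear part in the unknowns. -/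
theorem IsRegular.exists_isSolution_of_le {S : BriotBouquetSystem} {α β : ℝ} (hα : 1 ≤ α)
    (hβ : 1 ≤ β) (hS : S.IsRegular (-α) (-β)) : ∃ u v, S.IsSolution u v := by
  obtain ⟨R, hR, hdiff, hlip⟩ := hS.exists_lipschitz
  -- The bound `R / 4` at the zero function, plus `R / 4` from the Lipschitz constant `1/2` on
  -- functions of norm at most `R / 2`, keeps the remainders within `R / 2`.
  have hcont : ∀ᶠ t : ℂ in 𝓝 0, ‖S.f t 0 0‖ < R / 4 ∧ ‖S.g t 0 0‖ < R / 4 := by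
    have hc : ContinuousAt (fun t : ℂ => ((t, 0, 0) : ℂ × ℂ × ℂ)) 0 := by fun_prop
    have h1 : ContinuousAt (fun t : ℂ => S.f t 0 0) 0 :=
      ContinuousAt.comp' (g := fun w : ℂ × ℂ × ℂ => S.f w.1 w.2.1 w.2.2)
        (f := fun t : ℂ => ((t, 0, 0) : ℂ × ℂ × ℂ)) hS.analyticAt_f.continuousAt hc
    have h2 : ContinuousAt (fun t : ℂ => S.g t 0 0) 0 :=
      ContinuousAt.comp' (g := fun w : ℂ × ℂ × ℂ => S.g w.1 w.2.1 w.2.2)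
        (f := fun t : ℂ => ((t, 0, 0) : ℂ × ℂ × ℂ)) hS.analyticAt_g.continuousAt hc
    refine (h1.norm.eventually (gt_mem_nhds ?_)).and (h2.norm.eventually (gt_mem_nhds ?_)) <;>
      simp [hS.f_zero, hS.g_zero, hR]
  obtain ⟨r, hr, hcont⟩ := Metric.eventually_nhds_iff_ball.1 hcont
  set ρ := min r R with hρdef
  have hρ : 0 < ρ := lt_min hr hR
  have hB : ∀ {t : ℂ}, t ∈ Metric.ball (0 : ℂ) ρ → ‖t‖ < R := fun ht =>
    (mem_ball_zero_iff.1 ht).trans_le (min_le_right _ _)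
  have hB' : ∀ {t : ℂ}, t ∈ Metric.ball (0 : ℂ) ρ → ‖S.f t 0 0‖ < R / 4 ∧ ‖S.g t 0 0‖ < R / 4 :=
    fun ht => hcont _ (Metric.ball_subset_ball (min_le_left _ _) ht)
  set N₁ : (ℂ → ℂ × ℂ) → ℂ → ℂ := fun x t => S.f t (x t).1 (x t).2 + α * (x t).1 with hN₁
  set N₂ : (ℂ → ℂ × ℂ) → ℂ → ℂ := fun x t => S.g t (x t).1 (x t).2 + β * (x t).2 with hN₂
  set D : Set (ℂ → ℂ × ℂ) := {x | DifferentiableOn ℂ x (Metric.ball 0 ρ) ∧ x 0 = 0 ∧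
      ∀ t ∈ Metric.ball (0 : ℂ) ρ, ‖x t‖ ≤ R / 2} with hD
  have hN : ∀ x ∈ D, DifferentiableOn ℂ (N₁ x) (Metric.ball 0 ρ) ∧
      DifferentiableOn ℂ (N₂ x) (Metric.ball 0 ρ) := by
    rintro x ⟨hx, -, hxR⟩
    have hm : ∀ t ∈ Metric.ball (0 : ℂ) ρ, (t, x t) ∈ Metric.ball (0 : ℂ × ℂ × ℂ) R := by
      intro t ht
      rw [mem_ball_zero_iff, Prod.norm_mk, max_lt_iff]
      exact ⟨hB ht, by linarith [hxR t ht]⟩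
    constructor
    · intro t ht
      have h1 := (hdiff _ (hm t ht)).1
      exact DifferentiableAt.comp_differentiableWithinAt (f := fun t => (t, x t)) t h1
        (differentiableWithinAt_id.prodMk (hx t ht))
    · intro t ht
      have h1 := (hdiff _ (hm t ht)).2
      exact DifferentiableAt.comp_differentiableWithinAt (f := fun t => (t, x t)) t h1
        (differentiableWithinAt_id.prodMk (hx t ht))
  have hNb : ∀ x ∈ D, ∀ t ∈ Metric.ball (0 : ℂ) ρ, ‖N₁ x t‖ ≤ R / 2 ∧ ‖N₂ x t‖ ≤ R / 2 := by
    rintro x ⟨-, -, hxR⟩ t ht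
    have h1 := hlip t (x t) 0 (hB ht) (by linarith [hxR t ht]) (by simpa using hR)
    simp only [Prod.fst_zero, Prod.snd_zero, mul_zero, add_zero, sub_zero] at h1
    have h2 := hB' ht
    have h3 := hxR t ht
    constructor
    · have := norm_sub_norm_le (N₁ x t) (S.f t 0 0)
      linarith [h1.1, h2.1]
    · have := norm_sub_norm_le (N₂ x t) (S.g t 0 0)
      linarith [h1.2, h2.2]
  obtain ⟨x, hxD, hx⟩ := exists_holomorphic_fixedPoint hρ (by positivity) D hD
    (fun x t => (eulerIntegral α (N₁ x) t, eulerIntegral β (N₂ x) t)) (by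
      intro x hx
      refine ⟨?_, ?_, ?_⟩
      · intro t ht
        exact ((hasDerivAt_eulerIntegral hα (hN x hx).1 ht).differentiableAt.prodMk
          (hasDerivAt_eulerIntegral hβ (hN x hx).2 ht).differentiableAt).differentiableWithinAt
      · simp [eulerIntegral, hN₁, hN₂, hx.2.1, hS.f_zero, hS.g_zero]
      · intro t ht
        rw [Prod.norm_mk, max_le_iff]
        exact ⟨norm_eulerIntegral_le hα fun s hs => (hNb x hx _ (ofReal_mul_mem_ball hs ht)).1,
          norm_eulerIntegral_le hβ fun s hs => (hNb x hx _ (ofReal_mul_mem_ball hs ht)).2⟩) (by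
      intro x hx y hy C hC t ht
      have hl : ∀ s ∈ Set.Icc (0 : ℝ) 1, ‖N₁ x (s * t) - N₁ y (s * t)‖ ≤ C / 2 ∧
          ‖N₂ x (s * t) - N₂ y (s * t)‖ ≤ C / 2 := by
        intro s hs
        have hst := ofReal_mul_mem_ball hs ht
        have h1 := hlip (s * t) (x (s * t)) (y (s * t)) (hB hst)
          (by linarith [hx.2.2 _ hst]) (by linarith [hy.2.2 _ hst])
        have h2 := hC _ hst
        exact ⟨h1.1.trans (by linarith), h1.2.trans (by linarith)⟩
      rw [Prod.mk_sub_mk, Prod.norm_mk, max_le_iff]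
      exact ⟨norm_eulerIntegral_sub_le hα (hN x hx).1.continuousOn (hN y hy).1.continuousOn ht
          fun s hs => (hl s hs).1,
        norm_eulerIntegral_sub_le hβ (hN x hx).2.continuousOn (hN y hy).2.continuousOn ht
          fun s hs => (hl s hs).2⟩)
  have hball : Metric.ball (0 : ℂ) ρ ∈ 𝓝 0 := Metric.ball_mem_nhds 0 hρ
  have hx1 : Set.EqOn (fun t => (x t).1) (eulerIntegral α (N₁ x)) (Metric.ball 0 ρ) :=
    fun t ht => (congrArg Prod.fst (hx t ht)).symm
  have hx2 : Set.EqOn (fun t => (x t).2) (eulerIntegral β (N₂ x)) (Metric.ball 0 ρ) :=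
    fun t ht => (congrArg Prod.snd (hx t ht)).symm
  have han := hxD.1.analyticAt hball
  refine ⟨fun t => (x t).1, fun t => (x t).2, ?_, ?_, by simp [hxD.2.1], by simp [hxD.2.1], ?_, ?_⟩
  · exact analyticAt_fst.fun_comp han
  · exact analyticAt_snd.fun_comp han
  · filter_upwards [nhdsWithin_le_nhds hball] with t ht
    rw [(hx1.eventuallyEq_of_mem (Metric.isOpen_ball.mem_nhds ht)).deriv_eq]
    have := mul_deriv_eulerIntegral hα (hN x hxD).1 ht
    rw [← hx1 ht] at this
    simp only [hN₁] at this ⊢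
    linear_combination this
  · filter_upwards [nhdsWithin_le_nhds hball] with t ht
    rw [(hx2.eventuallyEq_of_mem (Metric.isOpen_ball.mem_nhds ht)).deriv_eq]
    have := mul_deriv_eulerIntegral hβ (hN x hxD).2 ht
    rw [← hx2 ht] at this
    simp only [hN₂] at this ⊢
    linear_combination this

/-- Where the difference `d` of two solutions has maximal norm on a closed disc, the Euler integral
over the segment from `0` gives `‖d‖ ≤ ‖d‖ / 2`, so `d` vanishes on the disc. -/
theorem IsRegular.eventuallyEq_of_le {S : BriotBouquetSystem} {α β : ℝ} (hα : 1 ≤ α)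
    (hβ : 1 ≤ β) (hS : S.IsRegular (-α) (-β)) {u v u' v' : ℂ → ℂ} (h : S.IsSolution u v)
    (h' : S.IsSolution u' v') : u' =ᶠ[𝓝 0] u ∧ v' =ᶠ[𝓝 0] v := by
  obtain ⟨R, hR, -, hlip⟩ := hS.exists_lipschitz
  have hgood : ∀ {u v}, S.IsSolution u v → ∀ᶠ t in 𝓝 0, DifferentiableAt ℂ u t ∧
      DifferentiableAt ℂ v t ∧ ‖u t‖ < R ∧ ‖v t‖ < R ∧ t * deriv u t = S.f t (u t) (v t) ∧
      t * deriv v t = S.g t (u t) (v t) := by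
    intro u v h
    have h1 := eventually_nhdsWithin_iff.1 h.eq_f
    have h2 := eventually_nhdsWithin_iff.1 h.eq_g
    filter_upwards [h.analyticAt_u.eventually_analyticAt, h.analyticAt_v.eventually_analyticAt,
      h.analyticAt_u.continuousAt.norm.eventually (gt_mem_nhds (by simpa [h.u_zero] using hR)),
      h.analyticAt_v.continuousAt.norm.eventually (gt_mem_nhds (by simpa [h.v_zero] using hR)),
      h1, h2] with t h3 h4 h5 h6 h7 h8
    refine ⟨h3.differentiableAt, h4.differentiableAt, h5, h6, ?_, ?_⟩
    · by_cases ht : t = 0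
      · simp [ht, h.u_zero, h.v_zero, hS.f_zero]
      · exact h7 ht
    · by_cases ht : t = 0
      · simp [ht, h.u_zero, h.v_zero, hS.g_zero]
      · exact h8 ht
  obtain ⟨r, hr, hball⟩ := Metric.eventually_nhds_iff_ball.1
    (((hgood h).and (hgood h')).and (Metric.ball_mem_nhds (0 : ℂ) hR))
  have hu : ∀ {u : ℂ → ℂ}, (∀ t ∈ Metric.ball (0 : ℂ) r, DifferentiableAt ℂ u t) →
      DifferentiableOn ℂ u (Metric.ball 0 r) := fun h t ht => (h t ht).differentiableWithinAt
  have hu1 := hu fun t ht => (hball t ht).1.1.1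
  have hv1 := hu fun t ht => (hball t ht).1.1.2.1
  have hu2 := hu fun t ht => (hball t ht).1.2.1
  have hv2 := hu fun t ht => (hball t ht).1.2.2.1
  have hc : ∀ {u : ℂ → ℂ} (a : ℂ), DifferentiableOn ℂ u (Metric.ball 0 r) →
      ContinuousOn (fun z => z * deriv u z + a * u z) (Metric.ball 0 r) := fun a hu =>
    (continuousOn_id.mul (hu.deriv Metric.isOpen_ball).continuousOn).add
      (continuousOn_const.mul hu.continuousOn)
  set d : ℂ → ℂ × ℂ := fun t => (u t - u' t, v t - v' t) with hd
  have hdc : ContinuousOn d (Metric.closedBall 0 (r / 2)) :=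
    (((hu1.continuousOn.sub hu2.continuousOn).prodMk
      (hv1.continuousOn.sub hv2.continuousOn))).mono
      (Metric.closedBall_subset_ball (by linarith))
  obtain ⟨t₀, ht₀, hmax⟩ := (isCompact_closedBall (0 : ℂ) (r / 2)).exists_isMaxOn
    (Metric.nonempty_closedBall.2 (by linarith)) hdc.norm
  have hcl : Metric.closedBall (0 : ℂ) (r / 2) ⊆ Metric.ball 0 r :=
    Metric.closedBall_subset_ball (by linarith)
  have ht₀' := hcl ht₀
  have hbound : ∀ s ∈ Set.Icc (0 : ℝ) 1,
      ‖((s * t₀) * deriv u (s * t₀) + α * u (s * t₀)) -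
        ((s * t₀) * deriv u' (s * t₀) + α * u' (s * t₀))‖ ≤ ‖d t₀‖ / 2 ∧
      ‖((s * t₀) * deriv v (s * t₀) + β * v (s * t₀)) -
        ((s * t₀) * deriv v' (s * t₀) + β * v' (s * t₀))‖ ≤ ‖d t₀‖ / 2 := by
    intro s hs
    have hst : (s : ℂ) * t₀ ∈ Metric.closedBall (0 : ℂ) (r / 2) := by
      rw [mem_closedBall_zero_iff] at ht₀ ⊢
      exact (norm_ofReal_mul_le hs t₀).trans ht₀
    obtain ⟨⟨⟨-, -, h1, h2, h3, h4⟩, -, -, h5, h6, h7, h8⟩, h9⟩ := hball _ (hcl hst)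
    rw [h3, h4, h7, h8]
    have h10 := hlip (s * t₀) (u (s * t₀), v (s * t₀)) (u' (s * t₀), v' (s * t₀))
      (mem_ball_zero_iff.1 h9) (by simp [Prod.norm_def, *]) (by simp [Prod.norm_def, *])
    have h11 : ‖d (s * t₀)‖ ≤ ‖d t₀‖ := hmax hst
    rw [Prod.mk_sub_mk] at h10
    exact ⟨h10.1.trans (by linarith), h10.2.trans (by linarith)⟩
  have h1 := norm_eulerIntegral_sub_le hα (hc α hu1) (hc α hu2) ht₀' fun s hs => (hbound s hs).1
  have h2 := norm_eulerIntegral_sub_le hβ (hc β hv1) (hc β hv2) ht₀' fun s hs => (hbound s hs).2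
  rw [eulerIntegral_euler hα hu1 ht₀', eulerIntegral_euler hα hu2 ht₀'] at h1
  rw [eulerIntegral_euler hβ hv1 ht₀', eulerIntegral_euler hβ hv2 ht₀'] at h2
  have h3 : ‖d t₀‖ ≤ ‖d t₀‖ / 2 := by
    conv_lhs => rw [hd, Prod.norm_mk]
    exact max_le h1 h2
  have h4 : ∀ t ∈ Metric.closedBall (0 : ℂ) (r / 2), d t = 0 := by
    intro t ht
    have h5 : ‖d t‖ ≤ ‖d t₀‖ := hmax ht
    rw [← norm_le_zero_iff]
    linarith
  have hnear : Metric.closedBall (0 : ℂ) (r / 2) ∈ 𝓝 0 := Metric.closedBall_mem_nhds _ (by linarith)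
  constructor
  · filter_upwards [hnear] with t ht
    exact (sub_eq_zero.1 (congrArg Prod.fst (h4 t ht))).symm
  · filter_upwards [hnear] with t ht
    exact (sub_eq_zero.1 (congrArg Prod.snd (h4 t ht))).symm

/-- The Briot-Bouquet theorem: a system without resonances has exactly one holomorphic solution. -/
theorem IsRegular.hasUniqueSolution {S : BriotBouquetSystem} {q s : ℝ}
    (hS : S.IsRegular q s) (hq : ∀ n : ℕ, q ≠ n + 1) (hs : ∀ n : ℕ, s ≠ n + 1) :
    S.HasUniqueSolution := by
  -- `N` is a number of reduction steps after which both eigenvalues are at most `-1`.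
  obtain ⟨N, hN⟩ := exists_nat_ge (max q s + 1)
  have h1 : q ≤ N - 1 := by linarith [le_max_left q s]
  have h2 : s ≤ N - 1 := by linarith [le_max_right q s]
  clear hN
  induction N generalizing S q s with
  | zero =>
    have hS' : S.IsRegular (-((-q : ℝ) : ℂ)) (-((-s : ℝ) : ℂ)) := by simpa using hS
    have hα : 1 ≤ -q := by simp at h1; linarith
    have hβ : 1 ≤ -s := by simp at h2; linarith
    obtain ⟨u, v, h⟩ := hS'.exists_isSolution_of_le hα hβ
    exact ⟨u, v, h, fun u' v' h' => hS'.eventuallyEq_of_le hα hβ h h'⟩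
  | succ N ih =>
    have hq1 : (q : ℂ) ≠ 1 := by
      have := hq 0
      simp only [Nat.cast_zero, zero_add] at this
      exact_mod_cast this
    have hs1 : (s : ℂ) ≠ 1 := by
      have := hs 0
      simp only [Nat.cast_zero, zero_add] at this
      exact_mod_cast this
    have hnext := hS.next hq1 hs1 0
    refine hS.hasUniqueSolution_of_next hq1 hs1 0
      (ih (q := q - 1) (s := s - 1) (by push_cast; exact hnext) (fun n h => hq (n + 1) ?_)
      (fun n h => hs (n + 1) ?_) ?_ ?_) <;> push_cast at * <;> linarith

end BriotBouquetSystem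

/-! ### Resonances. -/

namespace BriotBouquetSystem

theorem reduce_succ (c : ℂ) (n : ℕ) (S : BriotBouquetSystem) :
    S.reduce c (n + 1) = (S.next c).reduce c n := rfl

theorem reduce_add (c : ℂ) (m n : ℕ) (S : BriotBouquetSystem) :
    S.reduce c (m + n) = (S.reduce c n).reduce c m := Function.iterate_add_apply _ _ _ _

/-- Reduction steps of a system which is not resonant at any of these steps. -/
theorem IsRegular.reduce {S : BriotBouquetSystem} {q s : ℂ} (hS : S.IsRegular q s) {n : ℕ}
    (h : ∀ k < n, q ≠ k + 1 ∧ s ≠ k + 1) (c : ℂ) :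
    (S.reduce c n).IsRegular (q - n) (s - n) ∧ S.reduce c n = S.reduce 0 n ∧
      ((S.reduce c n).HasNoSolution → S.HasNoSolution) ∧
      ((S.reduce c n).HasInfinitelyManySolutions → S.HasInfinitelyManySolutions) := by
  induction n generalizing S q s with
  | zero => exact ⟨by simpa [BriotBouquetSystem.reduce] using hS, rfl, id, id⟩
  | succ n ih =>
    have hq : q ≠ 1 := by simpa using (h 0 n.succ_pos).1
    have hs : s ≠ 1 := by simpa using (h 0 n.succ_pos).2
    have hshift : ∀ k < n, q - 1 ≠ k + 1 ∧ s - 1 ≠ k + 1 := by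
      intro k hk
      have := h (k + 1) (Nat.succ_lt_succ hk)
      push_cast at this
      exact ⟨fun e => this.1 (by linear_combination e), fun e => this.2 (by linear_combination e)⟩
    obtain ⟨h1, h2, h3, h4⟩ := ih (hS.next hq hs c) hshift
    simp only [reduce_succ]
    refine ⟨?_, ?_, fun e => hS.hasNoSolution_of_next hq hs c (h3 e),
      fun e => hS.hasInfinitelyManySolutions_of_next (h4 e)⟩
    · convert h1 using 1 <;> push_cast <;> ring
    · rw [h2, hS.next_eq_step hq, hS.next_eq_step hq]

/-- After `n` steps the second eigenvalue is `1` and `r` is the obstruction. If it vanishes, any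
`v'(0)` is allowed, and the following step leads to eigenvalues `q - n - 1` and `0`, where the
Briot–Bouquet theorem applies. The constant `c` has no effect, as the first eigenvalue never equals
`1`. -/
theorem IsRegular.resonance_right {S : BriotBouquetSystem} {q : ℝ} {n : ℕ}
    (hS : S.IsRegular q (n + 1)) (hq : ∀ k : ℕ, q ≠ k + 1) (c : ℂ) :
    ((S.reduce c n).r = 0 → S.HasInfinitelyManySolutions) ∧
      ((S.reduce c n).r ≠ 0 → S.HasNoSolution) := by
  have hq' : ∀ k : ℕ, (q : ℂ) ≠ k + 1 := fun k => by exact_mod_cast hq k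
  obtain ⟨h1, -, h3, h4⟩ := hS.reduce (n := n)
    (fun k hk => ⟨hq' k, by norm_cast; omega⟩) c
  rw [add_sub_cancel_left] at h1
  refine ⟨fun hr => h4 ?_, fun hr => h3 (h1.hasNoSolution_of_r_ne_zero hr)⟩
  have hqn : (q : ℂ) - n ≠ 1 := fun e => hq' n (by linear_combination e)
  refine h1.hasInfinitelyManySolutions_of_step_right
    (a := (S.reduce c n).p / (1 - (q - n))) fun b => ?_
  have h5 := h1.step (b := b) ((add_mul_eq_self_iff hqn).2 rfl) (by simp [hr])
  have h6 : ((S.reduce c n).step ((S.reduce c n).p / (1 - (q - n))) b).IsRegular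
      ((q - n - 1 : ℝ) : ℂ) ((0 : ℝ) : ℂ) := by simpa using h5
  obtain ⟨u, v, h, -⟩ := h6.hasUniqueSolution
    (fun k e => hq (n + 1 + k) (by push_cast; linarith)) (fun k => by positivity)
  exact ⟨u, v, h⟩

theorem IsRegular.resonance_left {S : BriotBouquetSystem} {s : ℝ} {m : ℕ}
    (hS : S.IsRegular (m + 1) s) (hs : ∀ k : ℕ, s ≠ k + 1) (c : ℂ) :
    ((S.reduce c m).p = 0 → S.HasInfinitelyManySolutions) ∧
      ((S.reduce c m).p ≠ 0 → S.HasNoSolution) := by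
  have hs' : ∀ k : ℕ, (s : ℂ) ≠ k + 1 := fun k => by exact_mod_cast hs k
  obtain ⟨h1, -, h3, h4⟩ := hS.reduce (n := m)
    (fun k hk => ⟨by norm_cast; omega, hs' k⟩) c
  rw [add_sub_cancel_left] at h1
  refine ⟨fun hp => h4 ?_, fun hp => h3 (h1.hasNoSolution_of_p_ne_zero hp)⟩
  have hsm : (s : ℂ) - m ≠ 1 := fun e => hs' m (by linear_combination e)
  refine h1.hasInfinitelyManySolutions_of_step_left
    (b := (S.reduce c m).r / (1 - (s - m))) fun a => ?_
  have h5 := h1.step (a := a) (by simp [hp]) ((add_mul_eq_self_iff hsm).2 rfl)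
  have h6 : ((S.reduce c m).step a ((S.reduce c m).r / (1 - (s - m)))).IsRegular
      ((0 : ℝ) : ℂ) ((s - m - 1 : ℝ) : ℂ) := by simpa using h5
  obtain ⟨u, v, h, -⟩ := h6.hasUniqueSolution
    (fun k => by positivity) (fun k e => hs (m + 1 + k) (by push_cast; linarith))
  exact ⟨u, v, h⟩

/-- Since `m < n`, the first equation resonates first. If its obstruction vanishes, every choice of
`c` leaves first eigenvalue `0` and a single resonance in the second equation. -/
theorem IsRegular.resonance_both {S : BriotBouquetSystem} {m n : ℕ}
    (hS : S.IsRegular (m + 1) (n + 1)) (hmn : m < n) :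
    ((S.reduce 0 m).p = 0 → (∃ c, (S.reduce c n).r = 0) → S.HasInfinitelyManySolutions) ∧
      ((S.reduce 0 m).p ≠ 0 → S.HasNoSolution) ∧
      ((S.reduce 0 m).p = 0 → (∀ c, (S.reduce c n).r ≠ 0) → S.HasNoSolution) := by
  -- With `n = m + j + 1`: there are `m` ordinary steps, one free step, and `j` more until the
  -- second eigenvalue is `1`.
  obtain ⟨j, rfl⟩ := Nat.exists_eq_add_of_lt hmn
  have hred := hS.reduce (n := m) (fun k hk =>
    ⟨by norm_cast; omega, by norm_cast; omega⟩)
  obtain ⟨h1, -, h3, h4⟩ := hred 0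
  rw [add_sub_cancel_left] at h1
  have hs : (((m + j + 1 : ℕ) : ℂ) + 1 - m) ≠ 1 := by
    push_cast
    intro e
    have : (j : ℂ) + 1 = 0 := by linear_combination e
    exact Nat.cast_add_one_ne_zero j this
  -- The first `m` steps do not depend on `c`, which enters only at the free step.
  have hr : ∀ c, S.reduce c (m + j + 1) = ((S.reduce 0 m).next c).reduce c j := by
    intro c
    rw [← (hred c).2.1, ← reduce_succ, ← reduce_add]
    congr 1
    omega
  have hres : ∀ c, (S.reduce 0 m).p = 0 →
      ((S.reduce c (m + j + 1)).r = 0 → ((S.reduce 0 m).next c).HasInfinitelyManySolutions) ∧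
      ((S.reduce c (m + j + 1)).r ≠ 0 → ((S.reduce 0 m).next c).HasNoSolution) := by
    intro c hp
    rw [hr]
    refine IsRegular.resonance_right (q := 0) ?_ (fun k => by positivity) c
    convert h1.next_free hp hs c using 1
    · simp
    · push_cast; ring
  refine ⟨fun hp hc => ?_, fun hp => h3 (h1.hasNoSolution_of_p_ne_zero hp), fun hp hc => h3 ?_⟩
  · obtain ⟨c, hc⟩ := hc
    exact h4 (h1.hasInfinitelyManySolutions_of_next ((hres c hp).1 hc))
  · exact h1.hasNoSolution_of_next_free hs fun c => (hres c hp).2 (hc c)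

end BriotBouquetSystem

/-! ### Linearization and isochronous orbits of scalar fields. -/

/-- A holomorphic vector field on the line with a simple zero at `0` is linearizable near `0`. -/
theorem AnalyticAt.exists_linearization {h : ℂ → ℂ} {l : ℂ} (hh : AnalyticAt ℂ h 0)
    (h0 : h 0 = 0) (h1 : deriv h 0 = l) (hl : l ≠ 0) :
    ∃ φ : ℂ → ℂ, AnalyticAt ℂ φ 0 ∧ φ 0 = 0 ∧ deriv φ 0 ≠ 0 ∧
      ∀ᶠ t in 𝓝 0, deriv φ t * h t = l * φ t := by
  have hk : AnalyticAt ℂ (dslope h 0) 0 := by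
    obtain ⟨p, hp⟩ := hh
    exact hp.has_fpower_series_dslope_fslope.analyticAt
  have hk0 : dslope h 0 0 = l := by rw [dslope_same, h1]
  have hht : ∀ t, h t = t * dslope h 0 t := fun t => by
    have := sub_smul_dslope h 0 t
    simpa [h0] using this.symm
  -- The equation `φ'/φ = l/h` is solved by splitting off the pole: `l/h = 1/t + G'` with `G'`
  -- holomorphic, whence `φ = t exp G`.
  have hg : AnalyticAt ℂ (fun t => l / dslope h 0 t) 0 :=
    analyticAt_const.div hk (by rwa [hk0])
  have hgs : AnalyticAt ℂ (dslope (fun t => l / dslope h 0 t) 0) 0 := by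
    obtain ⟨p, hp⟩ := hg
    exact hp.has_fpower_series_dslope_fslope.analyticAt
  have hgt : ∀ t, l / dslope h 0 t = 1 + t * dslope (fun t => l / dslope h 0 t) 0 t := fun t => by
    have := sub_smul_dslope (fun t => l / dslope h 0 t) 0 t
    simp only [sub_zero, hk0, div_self hl, smul_eq_mul] at this
    rw [this]
    ring
  obtain ⟨r, hr, hball⟩ := Metric.eventually_nhds_iff_ball.1 hgs.eventually_analyticAt
  have hd : DifferentiableOn ℂ (dslope (fun t => l / dslope h 0 t) 0) (Metric.ball 0 r) :=
    fun t ht => (hball t ht).differentiableWithinAt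
  obtain ⟨G, hG⟩ := hd.isExactOn_ball
  have hGan : AnalyticAt ℂ G 0 :=
    DifferentiableOn.analyticAt (s := Metric.ball 0 r)
      (fun t ht => (hG t ht).differentiableAt.differentiableWithinAt) (Metric.ball_mem_nhds 0 hr)
  have hφ : ∀ t ∈ Metric.ball (0 : ℂ) r, HasDerivAt (fun t => t * Complex.exp (G t))
      (Complex.exp (G t) * (l / dslope h 0 t)) t := by
    intro t ht
    refine ((hasDerivAt_id t).fun_mul (hG t ht).cexp).congr_deriv ?_
    rw [hgt t]
    simp only [id]
    ring
  refine ⟨fun t => t * Complex.exp (G t), analyticAt_id.mul hGan.cexp, by simp, ?_, ?_⟩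
  · rw [(hφ 0 (Metric.mem_ball_self hr)).deriv, hk0, div_self hl, mul_one]
    exact Complex.exp_ne_zero _
  · filter_upwards [Metric.ball_mem_nhds 0 hr,
      hk.continuousAt.eventually_ne (by rwa [hk0])] with t ht hkt
    rw [(hφ t ht).deriv, hht t]
    field_simp

/-- Before time `2π/|ω|` the rotation has not completed a turn. This gives minimality of the period.
-/
theorem exp_I_mul_ne_one {ω t : ℝ} (hω : ω ≠ 0) (ht0 : 0 < t) (ht : t < 2 * Real.pi / |ω|) :
    Complex.exp (Complex.I * ω * t) ≠ 1 := by
  intro h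
  obtain ⟨n, hn⟩ := Complex.exp_eq_one_iff.1 h
  have h1 : ω * t = n * (2 * Real.pi) := by
    have : Complex.I * ((ω * t : ℝ) : ℂ) = Complex.I * ((n * (2 * Real.pi) : ℝ) : ℂ) := by
      push_cast
      linear_combination hn
    exact_mod_cast mul_left_cancel₀ Complex.I_ne_zero this
  have h2 : |ω| * t = |(n : ℝ)| * (2 * Real.pi) := by
    have := congrArg abs h1
    rwa [abs_mul, abs_mul, abs_of_pos ht0, abs_of_pos Real.two_pi_pos] at this
  rw [lt_div_iff₀ (abs_pos.2 hω)] at ht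
  have h3 : |(n : ℝ)| < 1 := by
    by_contra h4
    rw [not_lt] at h4
    nlinarith [Real.two_pi_pos]
  have h4 : n = 0 := Int.abs_lt_one_iff.1 (by exact_mod_cast h3)
  rw [h4] at h1
  simp [hω, ht0.ne'] at h1

/-- A holomorphic vector field on the line with a simple zero at `0` and purely imaginary linear
part has an isochronous center at `0`. -/
theorem AnalyticAt.exists_isochronous_orbits {h : ℂ → ℂ} {ω : ℝ} (hh : AnalyticAt ℂ h 0)
    (h0 : h 0 = 0) (h1 : deriv h 0 = Complex.I * ω) (hω : ω ≠ 0) {W : Set ℂ} (hW : W ∈ 𝓝 0) :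
    ∀ᶠ t₀ in 𝓝 (0 : ℂ), ∃ τ : ℝ → ℂ, τ 0 = t₀ ∧ (∀ s, HasDerivAt τ (h (τ s)) s) ∧
      (∀ s, τ s ∈ W) ∧ Function.Periodic τ (2 * Real.pi / |ω|) ∧
      (t₀ ≠ 0 → ∀ s, 0 < s → s < 2 * Real.pi / |ω| → τ s ≠ t₀) := by
  have hl : Complex.I * (ω : ℂ) ≠ 0 := mul_ne_zero Complex.I_ne_zero (by exact_mod_cast hω)
  obtain ⟨φ, hφ, hφ0, hφ1, hlin⟩ := hh.exists_linearization h0 h1 hl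
  have hstrict : HasStrictDerivAt φ (deriv φ 0) 0 := hφ.hasStrictDerivAt
  obtain ⟨R, hR, hR0⟩ : ∃ R : OpenPartialHomeomorph ℂ ℂ, (R : ℂ → ℂ) = φ ∧ (0 : ℂ) ∈ R.source :=
    ⟨(hstrict.hasStrictFDerivAt_equiv hφ1).toOpenPartialHomeomorph φ, rfl,
      HasStrictFDerivAt.mem_toOpenPartialHomeomorph_source _⟩
  have hRt : (0 : ℂ) ∈ R.target := by
    have := R.map_source hR0
    rwa [hR, hφ0] at this
  have hRs : R.symm 0 = 0 := by
    have := R.left_inv hR0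
    rwa [hR, hφ0] at this
  have hgood : ∀ᶠ t in 𝓝 (0 : ℂ), t ∈ W ∧ deriv φ t * h t = Complex.I * ω * φ t ∧
      DifferentiableAt ℂ φ t ∧ deriv φ t ≠ 0 := by
    filter_upwards [hW, hlin, hφ.eventually_analyticAt,
      hφ.deriv.continuousAt.eventually_ne hφ1] with t h1 h2 h3 h4
    exact ⟨h1, h2, h3.differentiableAt, h4⟩
  have htend : Filter.Tendsto R.symm (𝓝 0) (𝓝 0) := by
    have := R.symm.continuousAt (x := 0) hRt
    rwa [ContinuousAt, hRs] at this
  -- A disc in the linearizing coordinate is invariant under rotations, so the orbits `φ⁻¹(e^{iωs}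
  -- φ(t₀))` exist for all times and remain in `W`.
  obtain ⟨δ, hδ, hball⟩ := Metric.eventually_nhds_iff_ball.1
    ((htend.eventually hgood).and (R.open_target.mem_nhds hRt))
  have hφsmall : ∀ᶠ t in 𝓝 (0 : ℂ), φ t ∈ Metric.ball (0 : ℂ) δ :=
    hφ.continuousAt.eventually (by rw [hφ0]; exact Metric.ball_mem_nhds 0 hδ)
  filter_upwards [hφsmall, R.open_source.mem_nhds hR0] with t₀ ht₀ hts
  have hy : ∀ s : ℝ, Complex.exp (Complex.I * ω * s) * φ t₀ ∈ Metric.ball (0 : ℂ) δ := by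
    intro s
    rw [mem_ball_zero_iff, norm_mul]
    have : ‖Complex.exp (Complex.I * ω * s)‖ = 1 := by
      rw [mul_assoc, mul_comm, ← Complex.ofReal_mul]
      exact Complex.norm_exp_ofReal_mul_I _
    rw [this, one_mul]
    exact mem_ball_zero_iff.1 ht₀
  have hφR : ∀ s : ℝ, φ (R.symm (Complex.exp (Complex.I * ω * s) * φ t₀)) =
      Complex.exp (Complex.I * ω * s) * φ t₀ := fun s => by
    have := R.right_inv (hball _ (hy s)).2
    rwa [hR] at this
  have hinit : R.symm (φ t₀) = t₀ := by
    have := R.left_inv hts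
    rwa [hR] at this
  refine ⟨fun s => R.symm (Complex.exp (Complex.I * ω * s) * φ t₀), by simpa using hinit,
    fun s => ?_, fun s => (hball _ (hy s)).1.1, fun s => ?_, fun ht s hs0 hs heq => ?_⟩
  · obtain ⟨⟨-, h2, h3, h4⟩, h5⟩ := hball _ (hy s)
    have h6 : HasDerivAt R.symm (deriv φ _)⁻¹ (Complex.exp (Complex.I * ω * s) * φ t₀) :=
      R.hasDerivAt_symm h5 h4 (by rw [hR]; exact h3.hasDerivAt)
    have h7 : HasDerivAt (fun s : ℝ => Complex.exp (Complex.I * ω * s) * φ t₀)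
        (Complex.exp (Complex.I * ω * s) * (Complex.I * ω * 1) * φ t₀) s :=
      (((Complex.ofRealCLM.hasDerivAt (x := s)).const_mul (Complex.I * (ω : ℂ))).cexp).mul_const _
    refine (h6.comp s h7).congr_deriv ?_
    rw [hφR] at h2
    rw [inv_mul_eq_iff_eq_mul₀ h4, h2]
    ring
  · have : Complex.exp (Complex.I * ω * ((s + 2 * Real.pi / |ω| : ℝ) : ℂ)) =
        Complex.exp (Complex.I * ω * s) := by
      rw [Complex.exp_eq_exp_iff_exists_int]
      have hω' : (ω : ℂ) ≠ 0 := by exact_mod_cast hω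
      rcases abs_cases ω with ⟨h, -⟩ | ⟨h, -⟩
      · refine ⟨1, ?_⟩
        rw [h]
        push_cast
        field_simp
      · refine ⟨-1, ?_⟩
        rw [h]
        push_cast
        field_simp
    simp only [this]
  · have h2 := hφR s
    simp only at heq
    rw [heq] at h2
    have h3 : φ t₀ ≠ 0 := fun h => ht (by rw [← hinit, h, hRs])
    exact exp_I_mul_ne_one hω hs0 hs (mul_right_cancel₀ h3 (by rw [← h2, one_mul]))

/-! ### Center manifolds and invariant graphs. -/

/-- The holomorphic curve `γ` is parametrized by the `k`-th coordinate, tangent to the `k`-th axis at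
the origin, and the vector field `F` is tangent to it. -/
structure IsInvariantGraph (F : PhaseSpace → PhaseSpace) (k : Fin 3) (ρ : ℝ) (γ : ℂ → PhaseSpace) :
    Prop where
  pos : 0 < ρ
  analyticOnNhd : AnalyticOnNhd ℂ γ (Metric.ball 0 ρ)
  coord : ∀ t ∈ Metric.ball (0 : ℂ) ρ, γ t k = t
  map_zero : γ 0 = 0
  deriv_zero : deriv γ 0 = Pi.single k 1
  invariant : ∀ t ∈ Metric.ball (0 : ℂ) ρ, F (γ t) = F (γ t) k • deriv γ t

theorem IsHolomorphicCenterManifold.exists_isInvariantGraph {F : PhaseSpace → PhaseSpace}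
    {U : Set PhaseSpace} {k : Fin 3} {M : Set PhaseSpace}
    (hM : IsHolomorphicCenterManifold F U k M) :
    ∃ ρ γ, IsInvariantGraph F k ρ γ ∧ M = γ '' Metric.ball 0 ρ := by
  obtain ⟨⟨ρ, hρ, γ, hγ, hk, h0, h1, rfl⟩, -, hinv⟩ := hM
  refine ⟨ρ, γ, ⟨hρ, hγ, hk, h0, h1, fun t ht => ?_⟩, rfl⟩
  obtain ⟨ε, hε, c, hc0, hc⟩ := hinv _ (Set.mem_image_of_mem γ ht)
  have hd : HasDerivAt c (F (γ t)) 0 := by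
    have := (hc 0 ⟨by linarith, hε⟩).1
    rwa [hc0] at this
  have hdk : HasDerivAt (fun s => c s k) (F (γ t) k) 0 := hasDerivAt_pi.1 hd k
  have hck : c 0 k = t := by rw [hc0, hk t ht]
  have hcomp : HasDerivAt (fun s => γ (c s k)) (F (γ t) k • deriv γ t) 0 := by
    have h2 : HasDerivAt γ (deriv γ t) (c 0 k) := by
      rw [hck]; exact (hγ t ht).differentiableAt.hasDerivAt
    exact HasDerivAt.scomp (0 : ℝ) h2 hdk
  refine hd.unique (hcomp.congr_of_eventuallyEq ?_)
  -- A solution that stays on the graph is recovered from its `k`-th coordinate: `c = γ ∘ c_k` near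
  -- time `0`.
  filter_upwards [Ioo_mem_nhds (show -ε < 0 by linarith) hε] with s hs
  obtain ⟨z, hz, hzs⟩ := (hc s hs).2
  rw [← hzs, hk z hz]

namespace IsInvariantGraph

variable {F : PhaseSpace → PhaseSpace} {U : Set PhaseSpace} {k : Fin 3} {ρ ρ' : ℝ}
  {γ γ' : ℂ → PhaseSpace} {ω : ℝ}

theorem analyticAt_zero (h : IsInvariantGraph F k ρ γ) : AnalyticAt ℂ γ 0 :=
  h.analyticOnNhd 0 (Metric.mem_ball_self h.pos)

/-- By tangency, `γ` carries orbits of the scalar field `t ↦ F (γ t) k` to orbits of `F`. -/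
theorem exists_orbits (h : IsInvariantGraph F k ρ γ) (hF : AnalyticAt ℂ F 0) (hF0 : F 0 = 0)
    (hω : ω ≠ 0) (hk : fderiv ℂ F 0 (Pi.single k 1) k = Complex.I * ω) {W : Set ℂ}
    (hW : W ∈ 𝓝 0) (hWρ : W ⊆ Metric.ball 0 ρ) :
    ∀ᶠ t₀ in 𝓝 (0 : ℂ), ∃ τ : ℝ → ℂ, τ 0 = t₀ ∧ Continuous τ ∧
      (∀ s, HasDerivAt (fun s => γ (τ s)) (F (γ (τ s))) s) ∧
      (∀ s, τ s ∈ W) ∧ Function.Periodic τ (2 * Real.pi / |ω|) ∧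
      (t₀ ≠ 0 → ∀ s, 0 < s → s < 2 * Real.pi / |ω| → τ s ≠ t₀) := by
  have hFγ : HasFDerivAt F (fderiv ℂ F 0) (γ 0) := by
    rw [h.map_zero]; exact hF.differentiableAt.hasFDerivAt
  have hγd : HasDerivAt γ (Pi.single k 1) 0 := by
    rw [← h.deriv_zero]; exact h.analyticAt_zero.differentiableAt.hasDerivAt
  have hd : HasDerivAt (fun t => F (γ t) k) (Complex.I * ω) 0 := by
    rw [← hk]
    exact hasDerivAt_pi.1 (hFγ.comp_hasDerivAt (0 : ℂ) hγd) k
  have han : AnalyticAt ℂ (fun t => F (γ t) k) 0 := by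
    have h1 : AnalyticAt ℂ (fun t => F (γ t)) 0 :=
      AnalyticAt.fun_comp (g := F) (by rw [h.map_zero]; exact hF) h.analyticAt_zero
    exact ((ContinuousLinearMap.proj (R := ℂ) (φ := fun _ : Fin 3 => ℂ) k).analyticAt _).fun_comp h1
  filter_upwards [han.exists_isochronous_orbits (by simp [h.map_zero, hF0]) hd.deriv hω hW]
    with t₀ ⟨τ, h1, h2, h3, h4, h5⟩
  refine ⟨τ, h1, continuous_iff_continuousAt.2 fun s => (h2 s).continuousAt, fun s => ?_, h3, h4, h5⟩
  rw [h.invariant _ (hWρ (h3 s))]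
  exact HasDerivAt.scomp s
    (h.analyticOnNhd _ (hWρ (h3 s))).differentiableAt.hasDerivAt (h2 s)

theorem containsIsochronousCenterFamily (h : IsInvariantGraph F k ρ γ) (hF : AnalyticAt ℂ F 0)
    (hF0 : F 0 = 0) (hω : ω ≠ 0) (hk : fderiv ℂ F 0 (Pi.single k 1) k = Complex.I * ω) :
    ContainsIsochronousCenterFamily F (γ '' Metric.ball 0 ρ) (2 * Real.pi / |ω|) := by
  refine ⟨div_pos Real.two_pi_pos (abs_pos.2 hω), fun V hV => ?_⟩
  have hW : γ ⁻¹' V ∩ Metric.ball 0 ρ ∈ 𝓝 (0 : ℂ) :=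
    Filter.inter_mem (h.analyticAt_zero.continuousAt.preimage_mem_nhds (by rwa [h.map_zero]))
      (Metric.ball_mem_nhds 0 h.pos)
  have horb := h.exists_orbits hF hF0 hω hk hW Set.inter_subset_right
  have hproj : Filter.Tendsto (fun p : PhaseSpace => p k) (𝓝 0) (𝓝 0) :=
    (continuous_apply k).tendsto' _ _ rfl
  refine ⟨_, hproj.eventually horb, ?_⟩
  rintro p ⟨⟨t₀, ht₀, rfl⟩, hp⟩ hp0
  obtain ⟨τ, h1, -, h2, h3, h4, h5⟩ := hp
  rw [h.coord t₀ ht₀] at h1 h5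
  refine ⟨fun s => γ (τ s), congrArg γ h1, h2,
    fun s => ⟨Set.mem_image_of_mem _ (h3 s).2, (h3 s).1⟩, fun s => by simp only [h4 s],
    fun s hs0 hs (heq : γ (τ s) = γ t₀) => h5 ?_ s hs0 hs ?_⟩
  · rintro rfl
    exact hp0 h.map_zero
  · rw [← h.coord _ (h3 s).2, heq, h.coord t₀ ht₀]

/-- The disc is shrunk to bring the graph into `U`. It need not be invariant under the scalar flow:
an orbit starting in it stays there for short times because it is open. -/
theorem exists_isHolomorphicCenterManifold (h : IsInvariantGraph F k ρ γ) (hF : AnalyticAt ℂ F 0)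
    (hF0 : F 0 = 0) (hU : U ∈ 𝓝 0) (hω : ω ≠ 0)
    (hk : fderiv ℂ F 0 (Pi.single k 1) k = Complex.I * ω) :
    ∃ r, IsInvariantGraph F k r γ ∧ IsHolomorphicCenterManifold F U k (γ '' Metric.ball 0 r) := by
  have horb := h.exists_orbits hF hF0 hω hk (Metric.ball_mem_nhds 0 h.pos) subset_rfl
  have hUγ : ∀ᶠ t in 𝓝 0, γ t ∈ U :=
    h.analyticAt_zero.continuousAt.preimage_mem_nhds (by rwa [h.map_zero])
  obtain ⟨r, hr, hball⟩ := Metric.eventually_nhds_iff_ball.1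
    ((horb.and hUγ).and (Metric.ball_mem_nhds 0 h.pos))
  have hsub : Metric.ball (0 : ℂ) r ⊆ Metric.ball 0 ρ := fun t ht => (hball t ht).2
  have h' : IsInvariantGraph F k r γ := ⟨hr, h.analyticOnNhd.mono hsub,
    fun t ht => h.coord t (hsub ht), h.map_zero, h.deriv_zero, fun t ht => h.invariant t (hsub ht)⟩
  refine ⟨r, h', ⟨r, hr, γ, h'.analyticOnNhd, h'.coord, h.map_zero, h.deriv_zero, rfl⟩, ?_, ?_⟩
  · rintro _ ⟨t, ht, rfl⟩
    exact (hball t ht).1.2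
  · rintro _ ⟨t, ht, rfl⟩
    obtain ⟨τ, h1, hτ, h2, -⟩ := (hball t ht).1.1
    have hnear : ∀ᶠ s in 𝓝 (0 : ℝ), τ s ∈ Metric.ball (0 : ℂ) r :=
      hτ.continuousAt.preimage_mem_nhds (by rw [h1]; exact Metric.isOpen_ball.mem_nhds ht)
    obtain ⟨ε, hε, hnear⟩ := Metric.eventually_nhds_iff_ball.1 hnear
    refine ⟨ε, hε, fun s => γ (τ s), congrArg γ h1, fun s hs => ⟨h2 s, ?_⟩⟩
    refine Set.mem_image_of_mem _ (hnear s ?_)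
    rwa [Real.ball_eq_Ioo, zero_sub, zero_add]

/-- The `k`-th coordinate of a point is its parameter, so the germ of the image determines the germ
of the map. -/
theorem image_eventuallyEq_iff (h : IsInvariantGraph F k ρ γ) (h' : IsInvariantGraph F k ρ' γ') :
    (γ '' Metric.ball 0 ρ : Set PhaseSpace) =ᶠ[𝓝 0] (γ' '' Metric.ball 0 ρ' : Set PhaseSpace) ↔
      γ =ᶠ[𝓝 0] γ' := by
  have hγ : Filter.Tendsto γ (𝓝 0) (𝓝 0) := by
    have := h.analyticAt_zero.continuousAt.tendsto
    rwa [h.map_zero] at this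
  have hproj : Filter.Tendsto (fun p : PhaseSpace => p k) (𝓝 0) (𝓝 0) :=
    (continuous_apply k).tendsto' _ _ rfl
  constructor
  · intro heq
    filter_upwards [hγ.eventually heq, Metric.ball_mem_nhds (0 : ℂ) h.pos] with t ht htb
    have h1 : γ t ∈ γ '' Metric.ball 0 ρ := Set.mem_image_of_mem γ htb
    have h2 : γ t ∈ γ' '' Metric.ball 0 ρ' := (Eq.to_iff ht).1 h1
    obtain ⟨z, hz, hzt⟩ := h2
    have h3 : z = t := by rw [← h'.coord z hz, hzt, h.coord t htb]
    rw [← hzt, h3]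
  · intro heq
    filter_upwards [hproj.eventually heq, hproj.eventually (Metric.ball_mem_nhds (0 : ℂ) h.pos),
      hproj.eventually (Metric.ball_mem_nhds (0 : ℂ) h'.pos)] with p hp hb hb'
    refine propext ⟨?_, ?_⟩
    · rintro ⟨t, ht, rfl⟩
      rw [h.coord t ht] at hp hb'
      exact ⟨t, hb', hp.symm⟩
    · rintro ⟨t, ht, rfl⟩
      rw [h'.coord t ht] at hp hb
      exact ⟨t, hb, hp⟩

end IsInvariantGraph

/-! ### Invariant graphs and solutions of the Briot–Bouquet system. -/

/-- The curve with `k`-th coordinate `t`, `i`-th coordinate `t * u t`, `j`-th coordinate `t * v t`. -/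
noncomputable def graphCurve (k i j : Fin 3) (u v : ℂ → ℂ) (t : ℂ) : PhaseSpace :=
  Pi.single k t + Pi.single i (t * u t) + Pi.single j (t * v t)

/-- `F` is holomorphic near its zero `0`, with diagonal linear part `i ω`, and `k`, `i`, `j` are the
three coordinates. -/
structure IsDiagonalCenter (F : PhaseSpace → PhaseSpace) (ω : Fin 3 → ℝ) (k i j : Fin 3) :
    Prop where
  analyticAt : AnalyticAt ℂ F 0
  map_zero : F 0 = 0
  fderiv_apply : ∀ x l, fderiv ℂ F 0 x l = Complex.I * ω l * x l
  ne_zero : ω k ≠ 0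
  ki : k ≠ i
  kj : k ≠ j
  ij : i ≠ j

namespace IsDiagonalCenter

variable {F : PhaseSpace → PhaseSpace} {U : Set PhaseSpace} {ω : Fin 3 → ℝ} {k i j : Fin 3}

theorem cases (h : IsDiagonalCenter F ω k i j) (l : Fin 3) : l = k ∨ l = i ∨ l = j := by
  have := h.ki; have := h.kj; have := h.ij
  omega

theorem graphCurve_k (h : IsDiagonalCenter F ω k i j) (u v : ℂ → ℂ) (t : ℂ) :
    graphCurve k i j u v t k = t := by simp [graphCurve, h.ki, h.kj]

theorem graphCurve_i (h : IsDiagonalCenter F ω k i j) (u v : ℂ → ℂ) (t : ℂ) :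
    graphCurve k i j u v t i = t * u t := by simp [graphCurve, h.ki.symm, h.ij]

theorem graphCurve_j (h : IsDiagonalCenter F ω k i j) (u v : ℂ → ℂ) (t : ℂ) :
    graphCurve k i j u v t j = t * v t := by simp [graphCurve, h.kj.symm, h.ij.symm]

theorem fderiv_single (h : IsDiagonalCenter F ω k i j) :
    fderiv ℂ F 0 (Pi.single k 1) k = Complex.I * ω k := by simp [h.fderiv_apply]

theorem eigenvalue_ne_zero (h : IsDiagonalCenter F ω k i j) : Complex.I * (ω k : ℂ) ≠ 0 :=
  mul_ne_zero Complex.I_ne_zero (by exact_mod_cast h.ne_zero)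

theorem ray_eq (τ u v : ℂ) :
    (Pi.single k τ + Pi.single i (τ * u) + Pi.single j (τ * v) : PhaseSpace) =
      τ • (Pi.single k 1 + Pi.single i u + Pi.single j v) := by
  ext l
  simp only [Pi.add_apply, Pi.smul_apply, Pi.single_apply, smul_eq_mul]
  split_ifs <;> ring

theorem analyticAt_component (h : IsDiagonalCenter F ω k i j) (l : Fin 3) :
    AnalyticAt ℂ (fun x => F x l) 0 :=
  ((ContinuousLinearMap.proj (R := ℂ) (φ := fun _ : Fin 3 => ℂ) l).analyticAt _).fun_comp
    h.analyticAt

theorem fderiv_component (h : IsDiagonalCenter F ω k i j) (l : Fin 3) (x : PhaseSpace) :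
    fderiv ℂ (fun x => F x l) 0 x = Complex.I * ω l * x l := by
  have := (hasFDerivAt_pi'.1 h.analyticAt.differentiableAt.hasFDerivAt l).fderiv
  rw [this, ← h.fderiv_apply]
  rfl

theorem analyticAt_quotient (h : IsDiagonalCenter F ω k i j) (l : Fin 3) :
    AnalyticAt ℂ (fun w : ℂ × ℂ × ℂ => dslope (fun τ => F (Pi.single k τ +
      Pi.single i (τ * w.2.1) + Pi.single j (τ * w.2.2)) l) 0 w.1) 0 := by
  simp only [ray_eq]
  have h1 := (h.analyticAt_component l).dslope_ray (by simp [h.map_zero]) (Pi.single k 1)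
  have h2 : AnalyticAt ℂ (fun w : ℂ × ℂ × ℂ =>
      ((w.1, Pi.single k 1 + Pi.single i w.2.1 + Pi.single j w.2.2) : ℂ × PhaseSpace)) 0 := by
    have hs : ∀ l, AnalyticAt ℂ (fun z : ℂ => (Pi.single l z : PhaseSpace)) 0 := fun l =>
      (ContinuousLinearMap.single ℂ (fun _ : Fin 3 => ℂ) l).analyticAt _
    have hu : AnalyticAt ℂ (fun w : ℂ × ℂ × ℂ => w.2.1) 0 := analyticAt_fst.fun_comp analyticAt_snd
    have hv : AnalyticAt ℂ (fun w : ℂ × ℂ × ℂ => w.2.2) 0 := analyticAt_snd.fun_comp analyticAt_snd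
    refine analyticAt_fst.prod ((analyticAt_const.add ?_).add ?_)
    · exact (hs i).fun_comp_of_eq hu rfl
    · exact (hs j).fun_comp_of_eq hv rfl
  exact h1.fun_comp_of_eq h2 (by simp)

theorem quotient_zero (h : IsDiagonalCenter F ω k i j) (l : Fin 3) (u v : ℂ) :
    dslope (fun τ => F (Pi.single k τ + Pi.single i (τ * u) + Pi.single j (τ * v)) l) 0 0 =
      Complex.I * ω l * (Pi.single k 1 + Pi.single i u + Pi.single j v : PhaseSpace) l := by
  simp only [ray_eq]
  rw [dslope_ray_zero (h := fun x => F x l) (h.analyticAt_component l).differentiableAt,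
    h.fderiv_component]

/-- At `t = 0` the divided components are `i ω_i u`, `i ω_j v` and `i ω_k`, so the quotients are
linear there and the denominator is nonzero. -/
theorem isRegular (h : IsDiagonalCenter F ω k i j) :
    (briotBouquetOf F k i j).IsRegular ((ω i / ω k - 1 : ℝ) : ℂ) ((ω j / ω k - 1 : ℝ) : ℂ) := by
  have hu : AnalyticAt ℂ (fun w : ℂ × ℂ × ℂ => w.2.1) 0 := analyticAt_fst.fun_comp analyticAt_snd
  have hv : AnalyticAt ℂ (fun w : ℂ × ℂ × ℂ => w.2.2) 0 := analyticAt_snd.fun_comp analyticAt_snd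
  have hk0 : ∀ u v : ℂ, dslope (fun τ => F (Pi.single k τ + Pi.single i (τ * u) +
      Pi.single j (τ * v)) k) 0 0 = Complex.I * ω k := fun u v => by
    rw [h.quotient_zero]
    simp [h.ki, h.kj]
  have hω : (ω k : ℂ) ≠ 0 := by exact_mod_cast h.ne_zero
  have hI := Complex.I_ne_zero
  have hne := h.eigenvalue_ne_zero
  have hf : AnalyticAt ℂ (fun w : ℂ × ℂ × ℂ => (briotBouquetOf F k i j).f w.1 w.2.1 w.2.2) 0 :=
    ((h.analyticAt_quotient i).div (h.analyticAt_quotient k) (by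
      simpa only [Prod.fst_zero, Prod.snd_zero, hk0] using hne)).sub hu
  have hg : AnalyticAt ℂ (fun w : ℂ × ℂ × ℂ => (briotBouquetOf F k i j).g w.1 w.2.1 w.2.2) 0 :=
    ((h.analyticAt_quotient j).div (h.analyticAt_quotient k) (by
      simpa only [Prod.fst_zero, Prod.snd_zero, hk0] using hne)).sub hv
  have hf0 : ∀ u v, (briotBouquetOf F k i j).f 0 u v = ((ω i / ω k - 1 : ℝ) : ℂ) * u + 0 := by
    intro u v
    simp only [briotBouquetOf, hk0]
    rw [h.quotient_zero]
    simp only [Pi.add_apply, Pi.single_apply, h.ki.symm, h.ij, if_true, if_false]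
    push_cast
    field_simp
    ring
  have hg0 : ∀ u v, (briotBouquetOf F k i j).g 0 u v = ((ω j / ω k - 1 : ℝ) : ℂ) * v + 0 := by
    intro u v
    simp only [briotBouquetOf, hk0]
    rw [h.quotient_zero]
    simp only [Pi.add_apply, Pi.single_apply, h.kj.symm, h.ij.symm, if_true, if_false]
    push_cast
    field_simp
    ring
  refine ⟨hf, hg, by simp [hf0], by simp [hg0], ?_, ?_⟩
  · exact BriotBouquetSystem.fderiv_apply_of_slice hf.differentiableAt
      (l := fun u _ => ((ω i / ω k - 1 : ℝ) : ℂ) * u) (fun u v c => by ring) hf0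
  · exact BriotBouquetSystem.fderiv_apply_of_slice hg.differentiableAt
      (l := fun _ v => ((ω j / ω k - 1 : ℝ) : ℂ) * v) (fun u v c => by ring) hg0

theorem quotient_of_ne (h : IsDiagonalCenter F ω k i j) (l : Fin 3) (u v : ℂ → ℂ) {t : ℂ}
    (ht : t ≠ 0) :
    dslope (fun τ => F (Pi.single k τ + Pi.single i (τ * u t) + Pi.single j (τ * v t)) l) 0 t =
      F (graphCurve k i j u v t) l / t := by
  rw [dslope_of_ne _ ht, slope_def_field]
  simp [h.map_zero, graphCurve]

theorem f_of_ne (h : IsDiagonalCenter F ω k i j) (u v : ℂ → ℂ) {t : ℂ} (ht : t ≠ 0) :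
    (briotBouquetOf F k i j).f t (u t) (v t) =
      F (graphCurve k i j u v t) i / F (graphCurve k i j u v t) k - u t := by
  simp only [briotBouquetOf]
  rw [h.quotient_of_ne i u v ht, h.quotient_of_ne k u v ht, div_div_div_cancel_right₀ ht]

theorem g_of_ne (h : IsDiagonalCenter F ω k i j) (u v : ℂ → ℂ) {t : ℂ} (ht : t ≠ 0) :
    (briotBouquetOf F k i j).g t (u t) (v t) =
      F (graphCurve k i j u v t) j / F (graphCurve k i j u v t) k - v t := by
  simp only [briotBouquetOf]
  rw [h.quotient_of_ne j u v ht, h.quotient_of_ne k u v ht, div_div_div_cancel_right₀ ht]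

theorem hasDerivAt_graphCurve {u v : ℂ → ℂ} {t : ℂ} (hu : DifferentiableAt ℂ u t)
    (hv : DifferentiableAt ℂ v t) :
    HasDerivAt (graphCurve k i j u v)
      (Pi.single k 1 + Pi.single i (u t + t * deriv u t) + Pi.single j (v t + t * deriv v t)) t := by
  have hs : ∀ (l : Fin 3) {y : ℂ → ℂ} {y' : ℂ}, HasDerivAt y y' t →
      HasDerivAt (fun t => (Pi.single l (y t) : PhaseSpace)) (Pi.single l y') t := fun l y y' hy =>
    (ContinuousLinearMap.single ℂ (fun _ : Fin 3 => ℂ) l).hasFDerivAt.comp_hasDerivAt t hy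
  refine ((hs k (hasDerivAt_id t)).add (hs i ?_)).add (hs j ?_)
  · simpa using (hasDerivAt_id t).fun_mul hu.hasDerivAt
  · simpa using (hasDerivAt_id t).fun_mul hv.hasDerivAt

theorem analyticAt_graphCurve {u v : ℂ → ℂ} (hu : AnalyticAt ℂ u 0) (hv : AnalyticAt ℂ v 0) :
    AnalyticAt ℂ (graphCurve k i j u v) 0 := by
  have hs : ∀ (l : Fin 3) {y : ℂ → ℂ}, AnalyticAt ℂ y 0 →
      AnalyticAt ℂ (fun t => (Pi.single l (y t) : PhaseSpace)) 0 := fun l y hy =>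
    ((ContinuousLinearMap.single ℂ (fun _ : Fin 3 => ℂ) l).analyticAt _).fun_comp hy
  exact ((hs k analyticAt_id).add (hs i (analyticAt_id.mul hu))).add (hs j (analyticAt_id.mul hv))

theorem graphCurve_zero (u v : ℂ → ℂ) : graphCurve k i j u v 0 = 0 := by simp [graphCurve]

/-- Near the origin, the `k`-th component of `F` does not vanish on a curve tangent to the `k`-th
axis. -/
theorem eventually_ne_zero (h : IsDiagonalCenter F ω k i j) {γ : ℂ → PhaseSpace}
    (h0 : γ 0 = 0) (hγ : HasDerivAt γ (Pi.single k 1) 0) : ∀ᶠ t in 𝓝[≠] 0, F (γ t) k ≠ 0 := by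
  have hFγ : HasFDerivAt F (fderiv ℂ F 0) (γ 0) := by
    rw [h0]; exact h.analyticAt.differentiableAt.hasFDerivAt
  have hd : HasDerivAt (fun t => F (γ t) k) (Complex.I * ω k) 0 := by
    rw [← h.fderiv_single]
    exact hasDerivAt_pi.1 (hFγ.comp_hasDerivAt (0 : ℂ) hγ) k
  exact hd.eventually_ne h.eigenvalue_ne_zero

/-- The invariance equations of a curve. -/
theorem invariant_iff (h : IsDiagonalCenter F ω k i j) {u v : ℂ → ℂ} {t : ℂ} (ht : t ≠ 0)
    (hu : DifferentiableAt ℂ u t) (hv : DifferentiableAt ℂ v t)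
    (hne : F (graphCurve k i j u v t) k ≠ 0) :
    F (graphCurve k i j u v t) = F (graphCurve k i j u v t) k • deriv (graphCurve k i j u v) t ↔
      t * deriv u t = (briotBouquetOf F k i j).f t (u t) (v t) ∧
      t * deriv v t = (briotBouquetOf F k i j).g t (u t) (v t) := by
  rw [h.f_of_ne u v ht, h.g_of_ne u v ht, (hasDerivAt_graphCurve hu hv).deriv,
    eq_sub_iff_add_eq, eq_sub_iff_add_eq, eq_div_iff hne, eq_div_iff hne]
  constructor
  · intro heq
    constructor
    · have := congrFun heq i
      simp only [Pi.smul_apply, Pi.add_apply, Pi.single_apply, h.ki.symm, h.ij, if_true, if_false,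
        smul_eq_mul] at this
      rw [this]; ring
    · have := congrFun heq j
      simp only [Pi.smul_apply, Pi.add_apply, Pi.single_apply, h.kj.symm, h.ij.symm, if_true,
        if_false, smul_eq_mul] at this
      rw [this]; ring
  · rintro ⟨h1, h2⟩
    ext l
    rcases h.cases l with rfl | rfl | rfl
    · simp [h.ki, h.kj]
    · simp only [Pi.smul_apply, Pi.add_apply, Pi.single_apply, h.ki.symm, h.ij, if_true, if_false,
        smul_eq_mul]
      rw [← h1]; ring
    · simp only [Pi.smul_apply, Pi.add_apply, Pi.single_apply, h.kj.symm, h.ij.symm, if_true,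
        if_false, smul_eq_mul]
      rw [← h2]; ring

theorem exists_isInvariantGraph (h : IsDiagonalCenter F ω k i j) {u v : ℂ → ℂ}
    (huv : (briotBouquetOf F k i j).IsSolution u v) :
    ∃ ρ, IsInvariantGraph F k ρ (graphCurve k i j u v) := by
  have hγ := analyticAt_graphCurve (k := k) (i := i) (j := j) huv.analyticAt_u huv.analyticAt_v
  have hd : HasDerivAt (graphCurve k i j u v) (Pi.single k 1) 0 := by
    have := hasDerivAt_graphCurve (k := k) (i := i) (j := j) huv.analyticAt_u.differentiableAt
      huv.analyticAt_v.differentiableAt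
    simpa [huv.u_zero, huv.v_zero] using this
  have hev : ∀ᶠ t in 𝓝[≠] 0, F (graphCurve k i j u v t) =
      F (graphCurve k i j u v t) k • deriv (graphCurve k i j u v) t := by
    filter_upwards [h.eventually_ne_zero (graphCurve_zero u v) hd, self_mem_nhdsWithin,
      BriotBouquetSystem.eventually_differentiableAt huv.analyticAt_u,
      BriotBouquetSystem.eventually_differentiableAt huv.analyticAt_v, huv.eq_f, huv.eq_g]
      with t h1 h2 h3 h4 h5 h6
    exact (h.invariant_iff h2 h3 h4 h1).2 ⟨h5, h6⟩
  obtain ⟨ρ, hρ, hball⟩ := Metric.eventually_nhds_iff_ball.1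
    (hγ.eventually_analyticAt.and (eventually_nhdsWithin_iff.1 hev))
  refine ⟨ρ, hρ, fun t ht => (hball t ht).1, fun t _ => h.graphCurve_k u v t, graphCurve_zero u v,
    hd.deriv, fun t ht => ?_⟩
  by_cases ht0 : t = 0
  · simp [ht0, graphCurve_zero, h.map_zero]
  · exact (hball t ht).2 ht0

theorem exists_isSolution (h : IsDiagonalCenter F ω k i j) {ρ : ℝ} {γ : ℂ → PhaseSpace}
    (hγ : IsInvariantGraph F k ρ γ) :
    ∃ u v, (briotBouquetOf F k i j).IsSolution u v ∧ γ =ᶠ[𝓝 0] graphCurve k i j u v := by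
  have hd : HasDerivAt γ (Pi.single k 1) 0 := by
    rw [← hγ.deriv_zero]; exact hγ.analyticAt_zero.differentiableAt.hasDerivAt
  -- Tangency to the `k`-th axis makes the other coordinates vanish to second order, whence `u 0 =
  -- 0` after division by `t`.
  have hcomp : ∀ l, l ≠ k → ∃ u : ℂ → ℂ, AnalyticAt ℂ u 0 ∧ u 0 = 0 ∧ ∀ t, γ t l = t * u t := by
    intro l hl
    have han : AnalyticAt ℂ (fun t => γ t l) 0 :=
      ((ContinuousLinearMap.proj (R := ℂ) (φ := fun _ : Fin 3 => ℂ) l).analyticAt _).fun_comp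
        hγ.analyticAt_zero
    have hdl : deriv (fun t => γ t l) 0 = 0 := by
      rw [(hasDerivAt_pi.1 hd l).deriv]
      simp [hl]
    obtain ⟨u, hu, hu0, hut⟩ := BriotBouquetSystem.exists_eq_mul_add han (by simp [hγ.map_zero])
    exact ⟨u, hu, hu0, fun t => by rw [hut t, hdl, add_zero]⟩
  obtain ⟨u, hu, hu0, hut⟩ := hcomp i h.ki.symm
  obtain ⟨v, hv, hv0, hvt⟩ := hcomp j h.kj.symm
  have heq : Set.EqOn γ (graphCurve k i j u v) (Metric.ball 0 ρ) := by
    intro t ht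
    ext l
    rcases h.cases l with rfl | rfl | rfl
    · rw [h.graphCurve_k, hγ.coord t ht]
    · rw [h.graphCurve_i, hut]
    · rw [h.graphCurve_j, hvt]
  have hball := Metric.ball_mem_nhds (0 : ℂ) hγ.pos
  have hev : ∀ᶠ t in 𝓝[≠] 0, t * deriv u t = (briotBouquetOf F k i j).f t (u t) (v t) ∧
      t * deriv v t = (briotBouquetOf F k i j).g t (u t) (v t) := by
    filter_upwards [h.eventually_ne_zero hγ.map_zero hd, self_mem_nhdsWithin,
      BriotBouquetSystem.eventually_differentiableAt hu,
      BriotBouquetSystem.eventually_differentiableAt hv, nhdsWithin_le_nhds hball]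
      with t h1 h2 h3 h4 h5
    have h6 := hγ.invariant t h5
    rw [heq h5] at h1
    rw [(heq.eventuallyEq_of_mem (Metric.isOpen_ball.mem_nhds h5)).deriv_eq, heq h5] at h6
    exact (h.invariant_iff h2 h3 h4 h1).1 h6
  exact ⟨u, v, ⟨hu, hv, hu0, hv0, hev.mono fun _ h => h.1, hev.mono fun _ h => h.2⟩,
    heq.eventuallyEq_of_mem hball⟩

theorem graphCurve_eventuallyEq_iff (h : IsDiagonalCenter F ω k i j) {u v u' v' : ℂ → ℂ}
    (huv : (briotBouquetOf F k i j).IsSolution u v)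
    (huv' : (briotBouquetOf F k i j).IsSolution u' v') :
    graphCurve k i j u v =ᶠ[𝓝 0] graphCurve k i j u' v' ↔ u =ᶠ[𝓝 0] u' ∧ v =ᶠ[𝓝 0] v' := by
  constructor
  · intro heq
    constructor
    · refine BriotBouquetSystem.eventuallyEq_of_mul_add huv.analyticAt_u huv'.analyticAt_u
        (a := 0) (heq.mono fun t ht => ?_)
      have := congrFun ht i
      rw [h.graphCurve_i, h.graphCurve_i] at this
      simpa using this
    · refine BriotBouquetSystem.eventuallyEq_of_mul_add huv.analyticAt_v huv'.analyticAt_v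
        (a := 0) (heq.mono fun t ht => ?_)
      have := congrFun ht j
      rw [h.graphCurve_j, h.graphCurve_j] at this
      simpa using this
  · rintro ⟨h1, h2⟩
    filter_upwards [h1, h2] with t ht1 ht2
    rw [graphCurve, graphCurve, ht1, ht2]

theorem containsIsochronousCenterFamily (h : IsDiagonalCenter F ω k i j) {M : Set PhaseSpace}
    (hM : IsHolomorphicCenterManifold F U k M) :
    ContainsIsochronousCenterFamily F M (2 * Real.pi / |ω k|) := by
  obtain ⟨ρ, γ, hγ, rfl⟩ := hM.exists_isInvariantGraph
  exact hγ.containsIsochronousCenterFamily h.analyticAt h.map_zero h.ne_zero h.fderiv_single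

theorem exists_manifold (h : IsDiagonalCenter F ω k i j) (hU : U ∈ 𝓝 0) {u v : ℂ → ℂ}
    (huv : (briotBouquetOf F k i j).IsSolution u v) :
    ∃ r, IsInvariantGraph F k r (graphCurve k i j u v) ∧
      IsHolomorphicCenterManifold F U k (graphCurve k i j u v '' Metric.ball 0 r) := by
  obtain ⟨ρ, hρ⟩ := h.exists_isInvariantGraph huv
  exact hρ.exists_isHolomorphicCenterManifold h.analyticAt h.map_zero hU h.ne_zero h.fderiv_single

theorem hasOneCenterManifold (h : IsDiagonalCenter F ω k i j) (hU : U ∈ 𝓝 0)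
    (hS : (briotBouquetOf F k i j).HasUniqueSolution) :
    HasOneCenterManifold F U k (2 * Real.pi / |ω k|) := by
  obtain ⟨u, v, huv, huniq⟩ := hS
  obtain ⟨r, hr, hM⟩ := h.exists_manifold hU huv
  refine ⟨_, hM, h.containsIsochronousCenterFamily hM, fun M' hM' => ?_⟩
  obtain ⟨ρ, γ, hγ, rfl⟩ := hM'.exists_isInvariantGraph
  obtain ⟨u', v', huv', heq⟩ := h.exists_isSolution hγ
  exact (hγ.image_eventuallyEq_iff hr).2
    (heq.trans ((h.graphCurve_eventuallyEq_iff huv' huv).2 (huniq u' v' huv')))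

theorem hasInfinitelyManyCenterManifolds (h : IsDiagonalCenter F ω k i j) (hU : U ∈ 𝓝 0)
    (hS : (briotBouquetOf F k i j).HasInfinitelyManySolutions) :
    HasInfinitelyManyCenterManifolds F U k (2 * Real.pi / |ω k|) := by
  obtain ⟨u, v, huv, hne⟩ := hS
  choose r hr hM using fun n => h.exists_manifold hU (huv n)
  refine ⟨⟨_, hM, fun m n hmn heq => hne hmn ?_⟩, fun M hM =>
    h.containsIsochronousCenterFamily hM⟩
  exact (h.graphCurve_eventuallyEq_iff (huv m) (huv n)).1
    (((hr m).image_eventuallyEq_iff (hr n)).1 heq)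

theorem hasNoCenterManifold (h : IsDiagonalCenter F ω k i j)
    (hS : (briotBouquetOf F k i j).HasNoSolution) : HasNoCenterManifold F U k := by
  intro M hM
  obtain ⟨ρ, γ, hγ, rfl⟩ := hM.exists_isInvariantGraph
  obtain ⟨u, v, huv, -⟩ := h.exists_isSolution hγ
  exact hS u v huv

end IsDiagonalCenter

/-! ### Diagonal linear part, arithmetic of the ratios, and the theorem. -/

theorem apply_of_eigenspace_eq {D : PhaseSpace →L[ℂ] PhaseSpace} {ω : Fin 3 → ℝ}
    (h : ∀ l, Module.End.eigenspace (D : PhaseSpace →ₗ[ℂ] PhaseSpace) (Complex.I * ω l) =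
      Submodule.span ℂ {Pi.single l 1}) (x : PhaseSpace) (l : Fin 3) :
    D x l = Complex.I * ω l * x l := by
  have h1 : ∀ l, D (Pi.single l 1) = (Complex.I * ω l) • Pi.single l 1 := by
    intro l
    have h2 : (Pi.single l 1 : PhaseSpace) ∈
        Module.End.eigenspace (D : PhaseSpace →ₗ[ℂ] PhaseSpace) (Complex.I * ω l) := by
      rw [h l]
      exact Submodule.mem_span_singleton_self _
    exact Module.End.mem_eigenspace_iff.1 h2
  have h3 : x = ∑ m, x m • (Pi.single m 1 : PhaseSpace) := by
    ext l
    simp [Finset.sum_apply, Pi.single_apply]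
  conv_lhs => rw [h3]
  simp only [map_sum, map_smul, h1, Finset.sum_apply, Pi.smul_apply, Pi.single_apply, smul_eq_mul,
    mul_ite, mul_one, mul_zero, Finset.sum_ite_eq, Finset.mem_univ, if_true]
  ring

/-- Dividing by the frequency of larger modulus gives an eigenvalue at most `0`, which is never
resonant. -/
theorem div_sub_one_ne {a b : ℝ} (hab : |a| ≤ |b|) (n : ℕ) : a / b - 1 ≠ n + 1 := by
  have h1 : a / b ≤ 1 := by
    refine (le_abs_self _).trans ?_
    rw [abs_div]
    exact div_le_one_of_le₀ hab (abs_nonneg _)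
  have : (0 : ℝ) ≤ n := n.cast_nonneg
  intro h
  linarith

theorem sub_one_ne_of_not_nat {r : ℝ} (h : ¬ ∃ n : ℕ, r = n) (n : ℕ) : r - 1 ≠ n + 1 :=
  fun e => h ⟨n + 2, by push_cast; linarith⟩

/-- The order of the moduli excludes the ratio `0` and distinctness excludes `1`, so the truncated
`n - 2` in the theorem is a true subtraction. -/
theorem exists_eq_add_two {a b : ℝ} {n : ℕ} (hb : b ≠ 0) (hab : |b| ≤ |a|) (hne : b ≠ a)
    (h : a / b = n) : ∃ m, n = m + 2 := by
  have ha : a = n * b := by rw [← h, div_mul_cancel₀ _ hb]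
  refine Nat.exists_eq_add_of_le' ?_
  by_contra hn
  have hn : n = 0 ∨ n = 1 := by omega
  rcases hn with rfl | rfl
  · rw [ha] at hab
    simp [hb] at hab
  · simp [ha] at hne

theorem theoremT
    (U : Set PhaseSpace) (hU : IsOpen U) (h0U : (0 : PhaseSpace) ∈ U)
    (F : PhaseSpace → PhaseSpace) (hF : AnalyticOnNhd ℂ F U) (hF0 : F 0 = 0)
    (ω₁ ω₂ ω₃ : ℝ) (hω₁ : ω₁ ≠ 0)
    (h12 : ω₁ ≠ ω₂) (h13 : ω₁ ≠ ω₃) (h23 : ω₂ ≠ ω₃)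
    (hle12 : |ω₁| ≤ |ω₂|) (hle23 : |ω₂| ≤ |ω₃|)
    (hx : Module.End.eigenspace (fderiv ℂ F 0 : PhaseSpace →ₗ[ℂ] PhaseSpace) (Complex.I * ω₁) =
      Submodule.span ℂ {Pi.single 0 1})
    (hy : Module.End.eigenspace (fderiv ℂ F 0 : PhaseSpace →ₗ[ℂ] PhaseSpace) (Complex.I * ω₂) =
      Submodule.span ℂ {Pi.single 1 1})
    (hz : Module.End.eigenspace (fderiv ℂ F 0 : PhaseSpace →ₗ[ℂ] PhaseSpace) (Complex.I * ω₃) =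
      Submodule.span ℂ {Pi.single 2 1}) :
    -- 1)
    HasOneCenterManifold F U 2 (2 * Real.pi / |ω₃|) ∧
    -- 2)
    ((¬ ∃ n : ℕ, ω₃ / ω₂ = n) → HasOneCenterManifold F U 1 (2 * Real.pi / |ω₂|)) ∧
    -- 3)
    (∀ n : ℕ, ω₃ / ω₂ = n →
      let rbar : ℂ := ((briotBouquetOf F 1 0 2).reduce 0 (n - 2)).r
      (rbar = 0 → HasInfinitelyManyCenterManifolds F U 1 (2 * Real.pi / |ω₂|)) ∧
      (rbar ≠ 0 → HasNoCenterManifold F U 1)) ∧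
    -- 4)
    ((¬ ∃ m : ℕ, ω₂ / ω₁ = m) → (¬ ∃ n : ℕ, ω₃ / ω₁ = n) →
      HasOneCenterManifold F U 0 (2 * Real.pi / |ω₁|)) ∧
    -- 5)
    (∀ m : ℕ, ω₂ / ω₁ = m → (¬ ∃ n : ℕ, ω₃ / ω₁ = n) →
      let pbar : ℂ := ((briotBouquetOf F 0 1 2).reduce 0 (m - 2)).p
      (pbar = 0 → HasInfinitelyManyCenterManifolds F U 0 (2 * Real.pi / |ω₁|)) ∧
      (pbar ≠ 0 → HasNoCenterManifold F U 0)) ∧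
    -- 6)
    (∀ n : ℕ, (¬ ∃ m : ℕ, ω₂ / ω₁ = m) → ω₃ / ω₁ = n →
      let rhat : ℂ := ((briotBouquetOf F 0 1 2).reduce 0 (n - 2)).r
      (rhat = 0 → HasInfinitelyManyCenterManifolds F U 0 (2 * Real.pi / |ω₁|)) ∧
      (rhat ≠ 0 → HasNoCenterManifold F U 0)) ∧
    -- 7)
    (∀ m n : ℕ, ω₂ / ω₁ = m → ω₃ / ω₁ = n →
      let pbar : ℂ := ((briotBouquetOf F 0 1 2).reduce 0 (m - 2)).p
      let rhat : ℂ → ℂ := fun c => ((briotBouquetOf F 0 1 2).reduce c (n - 2)).r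
      ((pbar = 0 ∧ ∃ c, rhat c = 0) →
        HasInfinitelyManyCenterManifolds F U 0 (2 * Real.pi / |ω₁|)) ∧
      ((pbar ≠ 0 ∨ (pbar = 0 ∧ ∀ c, rhat c ≠ 0)) → HasNoCenterManifold F U 0)) := by
  have hω₂ : ω₂ ≠ 0 := abs_pos.1 ((abs_pos.2 hω₁).trans_le hle12)
  have hω₃ : ω₃ ≠ 0 := abs_pos.1 ((abs_pos.2 hω₂).trans_le hle23)
  have hUn : U ∈ 𝓝 (0 : PhaseSpace) := hU.mem_nhds h0U
  have hD := apply_of_eigenspace_eq (D := fderiv ℂ F 0) (ω := ![ω₁, ω₂, ω₃]) (fun l => by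
    fin_cases l
    · exact hx
    · exact hy
    · exact hz)
  have hcx : IsDiagonalCenter F ![ω₁, ω₂, ω₃] 0 1 2 :=
    ⟨hF 0 h0U, hF0, hD, hω₁, by decide, by decide, by decide⟩
  have hcy : IsDiagonalCenter F ![ω₁, ω₂, ω₃] 1 0 2 :=
    ⟨hF 0 h0U, hF0, hD, hω₂, by decide, by decide, by decide⟩
  have hcz : IsDiagonalCenter F ![ω₁, ω₂, ω₃] 2 0 1 :=
    ⟨hF 0 h0U, hF0, hD, hω₃, by decide, by decide, by decide⟩
  have hBx : (briotBouquetOf F 0 1 2).IsRegular ((ω₂ / ω₁ - 1 : ℝ) : ℂ) ((ω₃ / ω₁ - 1 : ℝ) : ℂ) :=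
    hcx.isRegular
  have hBy : (briotBouquetOf F 1 0 2).IsRegular ((ω₁ / ω₂ - 1 : ℝ) : ℂ) ((ω₃ / ω₂ - 1 : ℝ) : ℂ) :=
    hcy.isRegular
  have hBz : (briotBouquetOf F 2 0 1).IsRegular ((ω₁ / ω₃ - 1 : ℝ) : ℂ) ((ω₂ / ω₃ - 1 : ℝ) : ℂ) :=
    hcz.isRegular
  -- A ratio `n + 2` means eigenvalue `n + 1`, which reaches `1` after exactly `n` steps.
  have hcast : ∀ {r : ℝ} {n : ℕ}, r = (n + 2 : ℕ) → ((r - 1 : ℝ) : ℂ) = n + 1 := by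
    rintro r n rfl
    push_cast
    ring
  refine ⟨?_, fun h => ?_, fun n h => ?_, fun h h' => ?_, fun m h h' => ?_, fun n h h' => ?_,
    fun m n h h' => ?_⟩
  · exact hcz.hasOneCenterManifold hUn (hBz.hasUniqueSolution
      (div_sub_one_ne (hle12.trans hle23)) (div_sub_one_ne hle23))
  · exact hcy.hasOneCenterManifold hUn (hBy.hasUniqueSolution
      (div_sub_one_ne hle12) (sub_one_ne_of_not_nat h))
  · obtain ⟨n, rfl⟩ := exists_eq_add_two hω₂ hle23 h23 h
    rw [hcast h] at hBy
    have hres := hBy.resonance_right (div_sub_one_ne hle12) 0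
    exact ⟨fun hr => hcy.hasInfinitelyManyCenterManifolds hUn (hres.1 hr),
      fun hr => hcy.hasNoCenterManifold (hres.2 hr)⟩
  · exact hcx.hasOneCenterManifold hUn (hBx.hasUniqueSolution
      (sub_one_ne_of_not_nat h) (sub_one_ne_of_not_nat h'))
  · obtain ⟨m, rfl⟩ := exists_eq_add_two hω₁ hle12 h12 h
    rw [hcast h] at hBx
    have hres := hBx.resonance_left (sub_one_ne_of_not_nat h') 0
    exact ⟨fun hp => hcx.hasInfinitelyManyCenterManifolds hUn (hres.1 hp),
      fun hp => hcx.hasNoCenterManifold (hres.2 hp)⟩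
  · obtain ⟨n, rfl⟩ := exists_eq_add_two hω₁ (hle12.trans hle23) h13 h'
    rw [hcast h'] at hBx
    have hres := hBx.resonance_right (sub_one_ne_of_not_nat h) 0
    exact ⟨fun hr => hcx.hasInfinitelyManyCenterManifolds hUn (hres.1 hr),
      fun hr => hcx.hasNoCenterManifold (hres.2 hr)⟩
  · obtain ⟨m, rfl⟩ := exists_eq_add_two hω₁ hle12 h12 h
    obtain ⟨n, rfl⟩ := exists_eq_add_two hω₁ (hle12.trans hle23) h13 h'
    -- The moduli give `m ≤ n`, and equality would force `ω₂ = ω₃`.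
    have hmn : m < n := by
      rw [div_eq_iff hω₁] at h h'
      have hle : m ≤ n := by
        rw [h, h', abs_mul, abs_mul, Nat.abs_cast, Nat.abs_cast] at hle23
        have := le_of_mul_le_mul_right hle23 (abs_pos.2 hω₁)
        have : m + 2 ≤ n + 2 := by exact_mod_cast this
        omega
      refine hle.lt_of_ne ?_
      rintro rfl
      exact h23 (h.trans h'.symm)
    rw [hcast h, hcast h'] at hBx
    obtain ⟨h1, h2, h3⟩ := hBx.resonance_both hmn
    refine ⟨fun hp => hcx.hasInfinitelyManyCenterManifolds hUn (h1 hp.1 hp.2), ?_⟩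
    rintro (hp | hp)
    · exact hcx.hasNoCenterManifold (h2 hp)
    · exact hcx.hasNoCenterManifold (h3 hp.1 hp.2)
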